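/- Let $n\ge 1$, let $D$ be the flat affine connection on $\mathbb{R}^{n+1}$, and fix a nonzero parallel volume form $\Psi$. For smooth $F$ write $F_{i_1\dots i_k}=D_{i_1}\cdots D_{i_{k-1}}dF_{i_k}$ and $g_{ij}=F_{ij}$. Define $H(F)$ by $\det(F_{ij})=H(F)\Psi^2$, let $U^{ij}$ be the adjugate bivector, $U^{ip}F_{pj}=H(F)\delta_j{}^i$, and put $U(F)=U^{ij}F_iF_j$. Where $H(F)\neq 0$ let $g^{ij}$ be the inverse of $g_{ij}$, $F^i=g^{ij}F_j$, and $F_{ip}{}^{j}=g^{jq}F_{ipq}$. Where also $U(F)\ne0$ let $$\mu_i=\tfrac1{n+2}\,U(F)^{-1}d_iU(F),\qquad A(F)=1-F^p\mu_p,\qquad \nu_i=-|U(F)|^{-1/(n+2)}F_i ;$$ $\nu$ is the equiaffine conormal. Write $d\log H(F)=H(F)^{-1}dH(F)$. For a vector field $N$ transverse to a hypersurface, the induced connection $\nabla$, second fundamental form $h$, shape operator $S$ and connection one-form $\tau$ are defined by $D_XY=\nabla_XY+h(X,Y)N$ and $D_XN=-S(X)+\tau(X)N$ for $X,Y$ tangent.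 The equiaffine normal of a nondegenerate co-oriented hypersurface is the transverse field $N$, consistent with the co-orientation, for which $\tau=0$ and $|\Psi(N,X_1,\dots,X_n)|^2=|\det h(X_i,X_j)|$ for all tangent $X_1,\dots,X_n$. Its shape operator is the affine shape operator, and $\frac1n\operatorname{tr}S$ is the affine mean curvature. **Lemma.** Let $\Omega\subset\mathbb{R}^{n+1}$ and $I\subset\mathbb{R}$ be connected open sets, and let $F\in C^\infty(\Omega)$ be such that neither $H(F)$ nor $U(F)$ vanishes on $\Omega_I=F^{-1}(I)\cap\Omega$. For $r\in I$ let $L_r=\{x\in\Omega_I: F(x)=r\}$, co-oriented by $-\operatorname{sign}(U(F)H(F))F^i$. The equiaffine normals of the level sets $L_r$ form a smooth vector field $N$ on $\Omega_I$, and the following are equivalent: 1. $U(F)$ is locally constant on $L_r$ for each $r\in I$. 2. $\mu\wedge\nu=0$; equivalently, $\mu_i=U(F)^{-1}H(F)(1-A(F))F_i$. 3. $d\nu=0$. 4. The local flow $\phi_t$ of $N$ on $\Omega_I$ preserves the level sets of $F$, in the sense that for each $t$ the function $F\circ\phi_t$ is locally constant on the intersection of each $L_r$ with the domain of $\phi_t$.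 5. $\mathcal{L}_N\nu=0$. 6. $N^i$ is at each point of $\Omega_I$ a multiple of $F^i$; equivalently, $N^i=-\operatorname{sign}(U(F))\,H(F)\,|U(F)|^{-(n+1)/(n+2)}F^i$. If these conditions hold, then the affine mean curvature of $L_r$ is the restriction of $$\tfrac{n+2}{n}\operatorname{sign}(U(F))\,H(F)\,|U(F)|^{-(n+1)/(n+2)}A(F),$$ and the tensor $$S_i{}^j=-D_iN^j+\operatorname{sign}(U(F))\,|U(F)|^{-(n+1)/(n+2)}H(F)A(F)\,\nu_iN^j$$ is equal to $$\operatorname{sign}(U(F))H(F)|U(F)|^{-\frac{n+1}{n+2}}\Big(\delta_i{}^j-F_{ip}{}^jF^p+\big(d_i\log H(F)+U(F)^{-1}H(F)\big((n+2)A(F)-(n+1)\big)F_i\big)F^j\Big),$$ satisfies $F_jS_i{}^j=0$, and restricts along each $L_r$ to the affine shape operator of $L_r$. -/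

import Mathlib

open Set Filter Topology
open scoped ContDiff

namespace LevelSetAffine

noncomputable section

/-- The space `ℝ^{n+1}`, with its standard (affine) coordinates. -/
abbrev Space (n : ℕ) : Type := Fin (n + 1) → ℝ

/-- A parallel volume form on `ℝ^{n+1}`, i.e. a constant alternating form of top degree. -/
abbrev VolForm (n : ℕ) : Type := AlternatingMap ℝ (Space n) ℝ (Fin (n + 1))

/-- The standard basis vector `e_i`. -/
def basisVec {n : ℕ} (i : Fin (n + 1)) : Space n := Pi.single i 1

/-- The `i`-th partial derivative. -/
def pd {n : ℕ} (i : Fin (n + 1)) (f : Space n → ℝ) (x : Space n) : ℝ :=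
  fderiv ℝ f x (basisVec i)

/-- The components `F_i` of `dF`. -/
def grad {n : ℕ} (F : Space n → ℝ) (x : Space n) : Fin (n + 1) → ℝ :=
  fun i => pd i F x

/-- The Hessian `g_{ij} = F_{ij}`. -/
def hess {n : ℕ} (F : Space n → ℝ) (x : Space n) : Matrix (Fin (n + 1)) (Fin (n + 1)) ℝ :=
  Matrix.of fun i j => pd i (pd j F) x

/-- The third derivatives `F_{ijk}`. -/
def third {n : ℕ} (F : Space n → ℝ) (x : Space n) (i j k : Fin (n + 1)) : ℝ :=
  pd i (pd j (pd k F)) x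

/-- The Hessian determinant `H(F)`, defined by `det Hess F = H(F) Ψ²`. -/
def hessDet {n : ℕ} (Ψ : VolForm n) (F : Space n → ℝ) (x : Space n) : ℝ :=
  (hess F x).det / (Ψ basisVec) ^ 2

/-- The adjugate bivector `U^{ij}`, satisfying `U^{ip} F_{pj} = H(F) δ_j^i`. -/
def adjHess {n : ℕ} (Ψ : VolForm n) (F : Space n → ℝ) (x : Space n) :
    Matrix (Fin (n + 1)) (Fin (n + 1)) ℝ :=
  ((Ψ basisVec) ^ 2)⁻¹ • (hess F x).adjugate

/-- `U(F) = U^{ij} F_i F_j`. -/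
def uFun {n : ℕ} (Ψ : VolForm n) (F : Space n → ℝ) (x : Space n) : ℝ :=
  ∑ i, ∑ j, adjHess Ψ F x i j * grad F x i * grad F x j

/-- The vector field `F^i = g^{ij} F_j`. -/
def hessGrad {n : ℕ} (F : Space n → ℝ) (x : Space n) : Space n :=
  fun i => ∑ j, (hess F x)⁻¹ i j * grad F x j

/-- The one-form `μ = (n+2)⁻¹ d log U(F)`, where `d log f` means `f⁻¹ df`. -/
def muForm {n : ℕ} (Ψ : VolForm n) (F : Space n → ℝ) (x : Space n) : Space n →L[ℝ] ℝ :=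
  (1 / ((n : ℝ) + 2) * (uFun Ψ F x)⁻¹) • fderiv ℝ (uFun Ψ F) x

/-- The function `A(F) = 1 - F^p μ_p`. -/
def aFun {n : ℕ} (Ψ : VolForm n) (F : Space n → ℝ) (x : Space n) : ℝ :=
  1 - muForm Ψ F x (hessGrad F x)

/-- The equiaffine conormal one-form `ν = -|U(F)|^{-1/(n+2)} dF`. -/
def conormal {n : ℕ} (Ψ : VolForm n) (F : Space n → ℝ) (x : Space n) : Space n →L[ℝ] ℝ :=
  (-(|uFun Ψ F x| ^ (-(1 / ((n : ℝ) + 2))))) • fderiv ℝ F x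

/-- `|U(F)|^{-(n+1)/(n+2)} sign(U(F)) H(F)`. -/
def normalFactor {n : ℕ} (Ψ : VolForm n) (F : Space n → ℝ) (x : Space n) : ℝ :=
  Real.sign (uFun Ψ F x) * hessDet Ψ F x *
    |uFun Ψ F x| ^ (-(((n : ℝ) + 1) / ((n : ℝ) + 2)))

/-- The part of the `r`-level set of `F` that lies in `W`. -/
def levelSet {n : ℕ} (F : Space n → ℝ) (W : Set (Space n)) (r : ℝ) : Set (Space n) :=
  {x | x ∈ W ∧ F x = r}

/-- The tangent space at `x` to the level set of `F` through `x`. -/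
abbrev tangent {n : ℕ} (F : Space n → ℝ) (x : Space n) : Submodule ℝ (Space n) :=
  LinearMap.ker (fderiv ℝ F x).toLinearMap

/-- `h`, `S` and `τ` are, at the point `x`, the second fundamental form, the shape operator and
the connection one-form of the level set of `F` through `x` that are determined by the
transverse vector field `N` and the flat connection `D` through the splitting of
`ℝ^{n+1}` into the tangent space and the span of `N`:
`D_X Y = ∇_X Y + h(X, Y) N` and `D_X N = -S(X) + τ(X) N` for `X`, `Y` tangent,
where `∇_X Y` and `S(X)` are tangent. -/
structure IsInduced {n : ℕ} (F : Space n → ℝ) (N : Space n → Space n) (x : Space n)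
    (h : LinearMap.BilinForm ℝ (tangent F x))
    (S : tangent F x →ₗ[ℝ] tangent F x) (τ : tangent F x →ₗ[ℝ] ℝ) : Prop where
  transverse : N x ∉ tangent F x
  gauss : ∀ Y : Space n → Space n, ContDiffAt ℝ ∞ Y x →
    (∀ᶠ y in 𝓝 x, Y y ∈ tangent F y) →
    ∀ X Yx : tangent F x, (Yx : Space n) = Y x →
      fderiv ℝ Y x X - h X Yx • N x ∈ tangent F x
  weingarten : ∀ X : tangent F x, fderiv ℝ N x X = -(S X : Space n) + τ X • N x

/-- The vector field `N` restricts to every level set of `F` in `W` as its equiaffine normal with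
respect to `Ψ`: the induced connection one-form vanishes, and the induced volume form
`ι(N)Ψ` is, up to sign, the volume form of the induced second fundamental form `h`. The sign of
`N` is fixed by the co-orientation of the level sets: `N` points to the same side as
`-sign(U(F) H(F)) F^i`. -/
structure IsEquiaffineNormal {n : ℕ} (Ψ : VolForm n) (F : Space n → ℝ) (W : Set (Space n))
    (N : Space n → Space n) : Prop where
  smooth : ContDiffOn ℝ ∞ N W
  normalized : ∀ x ∈ W, ∃ (h : LinearMap.BilinForm ℝ (tangent F x))
    (S : tangent F x →ₗ[ℝ] tangent F x) (τ : tangent F x →ₗ[ℝ] ℝ),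
    IsInduced F N x h S τ ∧ τ = 0 ∧
      ∀ X : Fin n → tangent F x,
        |(Matrix.of fun i j => h (X i) (X j)).det| =
          (Ψ (Fin.cons (N x) fun i => (X i : Space n))) ^ 2
  cooriented : ∀ x ∈ W,
    0 < fderiv ℝ F x (N x) *
      fderiv ℝ F x (-(Real.sign (uFun Ψ F x * hessDet Ψ F x)) • hessGrad F x)

/-- `S` is the affine shape operator at `x` of the level set of `F` through `x`, when `N` is the
equiaffine normal. -/
def IsShapeOperator {n : ℕ} (F : Space n → ℝ) (N : Space n → Space n) (x : Space n)
    (S : tangent F x →ₗ[ℝ] tangent F x) : Prop :=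
  ∃ (h : LinearMap.BilinForm ℝ (tangent F x)) (τ : tangent F x →ₗ[ℝ] ℝ), IsInduced F N x h S τ

/-- The mean curvature `n⁻¹ tr S` of a hypersurface in `ℝ^{n+1}` with shape operator `S`. -/
def meanCurvature {n : ℕ} {F : Space n → ℝ} {x : Space n}
    (S : tangent F x →ₗ[ℝ] tangent F x) : ℝ :=
  1 / (n : ℝ) * LinearMap.trace ℝ (tangent F x) S

/-- The exterior product of two one-forms. -/
def wedge {n : ℕ} (α β : Space n → Space n →L[ℝ] ℝ) (x u v : Space n) : ℝ :=
  α x u * β x v - α x v * β x u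

/-- The exterior derivative of a one-form. -/
def extD {n : ℕ} (α : Space n → Space n →L[ℝ] ℝ) (x : Space n) :
    Space n [⋀^Fin 2]→L[ℝ] ℝ :=
  extDeriv (fun y => ContinuousAlternatingMap.ofSubsingleton ℝ (Space n) ℝ (0 : Fin 1) (α y)) x

/-- The Lie derivative of the one-form `α` along the vector field `N`,
`(L_N α)_i = N^p ∂_p α_i + α_p ∂_i N^p`. -/
def lieD {n : ℕ} (N : Space n → Space n) (α : Space n → Space n →L[ℝ] ℝ) (x : Space n) :
    Space n →L[ℝ] ℝ :=
  fderiv ℝ α x (N x) + (α x).comp (fderiv ℝ N x)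

/-- The local flow on `W` of the vector field `N` is defined at time `t` at `x` and takes
`x` to `y`. -/
def FlowsTo {n : ℕ} (W : Set (Space n)) (N : Space n → Space n) (t : ℝ) (x y : Space n) : Prop :=
  ∃ γ : ℝ → Space n, γ 0 = x ∧ γ t = y ∧ (∀ s ∈ uIcc 0 t, γ s ∈ W) ∧
    IsIntegralCurveOn γ (fun _ => N) (uIcc 0 t)

/-- The local flow `φ_t` of `N` on `W` preserves the foliation of `W` by the level sets of `F`:
for every `t`, the function `F ∘ φ_t` is locally constant along the level sets of `F`
in the (open) domain of `φ_t`. -/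
def FlowPreservesLevelSets {n : ℕ} (F : Space n → ℝ) (W : Set (Space n))
    (N : Space n → Space n) : Prop :=
  ∀ (t : ℝ) (x y : Space n), FlowsTo W N t x y →
    ∀ᶠ x' in 𝓝 x, F x' = F x → ∀ y', FlowsTo W N t x' y' → F y' = F y

/-- The endomorphism field
`S_i^j = -D_i N^j + sign(U(F)) |U(F)|^{-(n+1)/(n+2)} H(F) A(F) ν_i N^j`. -/
def shapeTensor {n : ℕ} (Ψ : VolForm n) (F : Space n → ℝ) (N : Space n → Space n)
    (x : Space n) : Space n →L[ℝ] Space n :=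
  -fderiv ℝ N x +
    (normalFactor Ψ F x * aFun Ψ F x) • (conormal Ψ F x).smulRight (N x)

/-- The components in terms of `F` of the endomorphism field,
`sign(U) H |U|^{-(n+1)/(n+2)} (δ_i^j - F_{ip}^j F^p
  + (d_i log H + U⁻¹ H ((n+2) A - (n+1)) F_i) F^j)`. -/
def shapeComponents {n : ℕ} (Ψ : VolForm n) (F : Space n → ℝ) (x : Space n)
    (i j : Fin (n + 1)) : ℝ :=
  normalFactor Ψ F x *
    ((if i = j then 1 else 0)
      - ∑ p, ∑ q, third F x i p q * (hess F x)⁻¹ q j * hessGrad F x p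
      + ((hessDet Ψ F x)⁻¹ * pd i (hessDet Ψ F) x
          + (uFun Ψ F x)⁻¹ * hessDet Ψ F x *
            (((n : ℝ) + 2) * aFun Ψ F x - ((n : ℝ) + 1)) * grad F x i) * hessGrad F x j)

end

end LevelSetAffine

/-!
The equiaffine normal `N` is characterized by `dF(N) = -|U|^{1/(n+2)}` together with
`dF(D_X N) = 0` for tangent `X`: the first equation is the normalization of the volume forms,
because `U Ψ(v, X₁, …, Xₙ)² = dF(v)² det g(X_i, X_j)` for tangent `X_i`, and the second is `τ = 0`.
Differentiating the first equation and inserting the second determines `g(N, ·)` on tangent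
vectors, which gives `N^i = -(|U|^{1/(n+2)} μ^i + sign(U) H |U|^{-(n+1)/(n+2)} A F^i)`.

Hence `N` is a multiple of `F^i` exactly when `μ` is a multiple of `dF`, and each remaining
condition says the same thing. For `dν` and `L_N ν` this is a pointwise computation. A function is
locally constant on the level sets of `F` exactly when its differential is a multiple of `dF`;
applied to `U` this handles the first condition, and applied to `dF(N)` the flow, since locally
`dF(N)` is then a Lipschitz function of `F`, so that `F ∘ φ_t` solves an ODE along each integral
curve.

The shape operator is the restriction of a tensor with `F_j S_i^j = 0`, so its trace may be taken
over the whole space, where Jacobi's formula identifies `F_{ip}^i F^p` with `F^p d_p log H`.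
-/

namespace LevelSetAffine

section FunctionalDependence

lemma exists_apply_eq_one {𝕜 E : Type*} [DivisionRing 𝕜] [TopologicalSpace 𝕜] [AddCommGroup E]
    [Module 𝕜 E] [TopologicalSpace E] {l : E →L[𝕜] 𝕜} (hl : l ≠ 0) : ∃ w, l w = 1 := by
  obtain ⟨v, hv⟩ := ContinuousLinearMap.exists_ne_zero hl
  exact ⟨(l v)⁻¹ • v, by simp [hv]⟩

variable {E : Type*} [NormedAddCommGroup E] [NormedSpace ℝ E]

lemma exists_openPartialHomeomorph_fderiv_apply_eq [CompleteSpace E] {F : E → ℝ} {p : E}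
    {k : ℕ∞ω} (hF : ContDiffAt ℝ k F p) (hk : k ≠ 0) (hp : fderiv ℝ F p ≠ 0) :
    ∃ e : OpenPartialHomeomorph E E, p ∈ e.source ∧ ContDiffAt ℝ k e.symm (e p) ∧
      ∀ y, fderiv ℝ F p (e y) = F y := by
  obtain ⟨w, hw⟩ := exists_apply_eq_one hp
  set l := fderiv ℝ F p with hl
  -- `Φ` straightens `F`: `l ∘ Φ = F` since `l w = 1`, and the derivative of `Φ` at `p` is `id`.
  let Φ : E → E := fun y => y + (F y - l y) • w
  have hΦ : ContDiffAt ℝ k Φ p :=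
    contDiffAt_id.add ((hF.sub l.contDiff.contDiffAt).smul contDiffAt_const)
  have hΦ' : HasFDerivAt Φ (ContinuousLinearEquiv.refl ℝ E : E →L[ℝ] E) p := by
    refine ((hasFDerivAt_id (𝕜 := ℝ) p).add
      (((hF.differentiableAt hk).hasFDerivAt.sub l.hasFDerivAt).smul_const w)).congr_fderiv ?_
    ext v
    simp [hl]
  exact ⟨hΦ.toOpenPartialHomeomorph Φ hΦ' hk, hΦ.mem_toOpenPartialHomeomorph_source hΦ' hk,
    hΦ.to_localInverse hΦ' hk, fun y => by simp [Φ, hw]⟩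

lemma eq_of_fderiv_apply_sub_eq_zero {g : E → ℝ} {s : Set E} (hs : Convex ℝ s) {a b : E}
    (ha : a ∈ s) (hb : b ∈ s) (hg : ∀ z ∈ s, DifferentiableAt ℝ g z)
    (h : ∀ z ∈ s, fderiv ℝ g z (b - a) = 0) : g a = g b := by
  obtain ⟨z, hz, hz'⟩ := domain_mvt (fun x hx => (hg x hx).hasFDerivAt.hasFDerivWithinAt) hs ha hb
  exact (sub_eq_zero.1 (hz'.trans (h z (hs.segment_subset ha hb hz)))).symm

lemma eventually_differentiableAt_of_contDiffAt {G : Type*} [NormedAddCommGroup G]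
    [NormedSpace ℝ G] {f : E → G} {p : E} {k : ℕ∞ω} (hk : k ≠ 0) (hf : ContDiffAt ℝ k f p) :
    ∀ᶠ y in 𝓝 p, DifferentiableAt ℝ f y :=
  ((hf.of_le (ENat.one_le_iff_ne_zero_withTop.2 hk)).eventually (by simp)).mono
    fun _ hy => hy.differentiableAt one_ne_zero

lemma fderiv_comp_apply_eq_zero {F U : E → ℝ} {ψ : E → E} {l : E →L[ℝ] ℝ} {z v : E}
    (hψ : DifferentiableAt ℝ ψ z) (hF : DifferentiableAt ℝ F (ψ z))
    (hU : DifferentiableAt ℝ U (ψ z)) (hFψ : F ∘ ψ =ᶠ[𝓝 z] l)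
    (h : ∀ v, fderiv ℝ F (ψ z) v = 0 → fderiv ℝ U (ψ z) v = 0) (hv : l v = 0) :
    fderiv ℝ (U ∘ ψ) z v = 0 := by
  have hFl : fderiv ℝ (F ∘ ψ) z = fderiv ℝ l z := hFψ.fderiv_eq
  rw [l.fderiv, fderiv_comp z hF hψ] at hFl
  rw [fderiv_comp z hU hψ]
  exact h _ ((DFunLike.congr_fun hFl v).trans hv)

variable [CompleteSpace E] {F U : E → ℝ} {p : E}

lemma exists_eventuallyEq_comp_of_ker_fderiv_le {k : ℕ∞ω} (hk : k ≠ 0) (hF : ContDiffAt ℝ k F p)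
    (hU : ContDiffAt ℝ k U p) (hp : fderiv ℝ F p ≠ 0)
    (h : ∀ᶠ y in 𝓝 p, ∀ v, fderiv ℝ F y v = 0 → fderiv ℝ U y v = 0) :
    ∃ u : ℝ → ℝ, ContDiffAt ℝ k u (F p) ∧ U =ᶠ[𝓝 p] u ∘ F := by
  obtain ⟨e, hpe, he, heF⟩ := exists_openPartialHomeomorph_fderiv_apply_eq hF hk hp
  obtain ⟨w, hw⟩ := exists_apply_eq_one hp
  set l := fderiv ℝ F p
  have hep : e.symm (e p) = p := e.left_inv hpe
  have hG : ContDiffAt ℝ k (U ∘ e.symm) (e p) := ContDiffAt.comp _ (by rwa [hep]) he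
  have hker : ∀ᶠ z in 𝓝 (e p), DifferentiableAt ℝ (U ∘ e.symm) z ∧
      ∀ v, l v = 0 → fderiv ℝ (U ∘ e.symm) z v = 0 := by
    have he' : Tendsto e.symm (𝓝 (e p)) (𝓝 p) := by simpa [hep] using he.continuousAt.tendsto
    filter_upwards [eventually_differentiableAt_of_contDiffAt hk he,
      he'.eventually (eventually_differentiableAt_of_contDiffAt hk hF),
      he'.eventually (eventually_differentiableAt_of_contDiffAt hk hU), he'.eventually h,
      e.open_target.mem_nhds (e.map_source hpe)] with z hez hFz hUz hz hzt
    refine ⟨hUz.comp z hez, fun v hv => fderiv_comp_apply_eq_zero hez hFz hUz ?_ hz hv⟩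
    filter_upwards [e.open_target.mem_nhds hzt] with z' hz'
    rw [Function.comp_apply, ← heF, e.right_inv hz']
  obtain ⟨r, hr, hball⟩ := Metric.eventually_nhds_iff_ball.1 hker
  let c : ℝ → E := fun t => e p + (t - F p) • w
  refine ⟨fun t => U (e.symm (c t)), ?_, ?_⟩
  · have hc : ContDiffAt ℝ k c (F p) := by fun_prop
    exact ContDiffAt.comp (g := U ∘ e.symm) (F p) (by simpa [c] using hG) hc
  · have hc : Tendsto (fun y => c (F y)) (𝓝 p) (𝓝 (e p)) := by
      simpa [c] using (tendsto_const_nhds (x := e p)).add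
        ((hF.continuousAt.tendsto.sub_const (F p)).smul_const w)
    filter_upwards [e.open_source.mem_nhds hpe, hc.eventually (Metric.ball_mem_nhds _ hr),
      (e.continuousAt hpe).eventually (Metric.ball_mem_nhds _ hr)] with y hy hcy hey
    have hlc : l (c (F y) - e y) = 0 := by simp [c, heF, hw]
    have := eq_of_fderiv_apply_sub_eq_zero (convex_ball (e p) r) hey hcy
      (fun z hz => (hball z hz).1) fun z hz => (hball z hz).2 _ hlc
    simpa [e.left_inv hy] using this

lemma exists_abs_sub_le_of_ker_fderiv_le (hF : ContDiffAt ℝ 1 F p)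
    (hU : ContDiffAt ℝ 1 U p) (hp : fderiv ℝ F p ≠ 0)
    (h : ∀ᶠ y in 𝓝 p, ∀ v, fderiv ℝ F y v = 0 → fderiv ℝ U y v = 0) :
    ∃ L : ℝ, 0 ≤ L ∧ ∀ᶠ q in 𝓝 (p, p), |U q.1 - U q.2| ≤ L * |F q.1 - F q.2| := by
  obtain ⟨u, hu, hUu⟩ := exists_eventuallyEq_comp_of_ker_fderiv_le one_ne_zero hF hU hp h
  obtain ⟨L, s, hs, hL⟩ := hu.exists_lipschitzOnWith
  have hFs := hUu.and (hF.continuousAt.eventually hs)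
  refine ⟨L, L.2, ?_⟩
  rw [nhds_prod_eq]
  filter_upwards [prod_mem_prod hFs hFs] with q ⟨⟨h₁, h₁'⟩, h₂, h₂'⟩
  simpa only [h₁, h₂, Function.comp_apply, Real.dist_eq] using hL.dist_le_mul _ h₁' _ h₂'

lemma exists_mem_nhds_exists_isPreconnected_level (hF : ContDiffAt ℝ 1 F p)
    (hp : fderiv ℝ F p ≠ 0) {V : Set E} (hV : V ∈ 𝓝 p) :
    ∃ V' ∈ 𝓝 p, ∀ a ∈ V', ∀ b ∈ V', F a = F b →
      ∃ C ⊆ V, IsPreconnected C ∧ a ∈ C ∧ b ∈ C ∧ ∀ y ∈ C, F y = F a := by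
  obtain ⟨e, hpe, he, heF⟩ := exists_openPartialHomeomorph_fderiv_apply_eq hF one_ne_zero hp
  set l := fderiv ℝ F p
  have hV' : ∀ᶠ z in 𝓝 (e p), z ∈ e.target ∧ e.symm z ∈ V :=
    (e.open_target.eventually_mem (e.map_source hpe)).and
      (he.continuousAt.eventually (by rwa [e.left_inv hpe]))
  obtain ⟨r, hr, hball⟩ := Metric.eventually_nhds_iff_ball.1 hV'
  refine ⟨e.source ∩ e ⁻¹' Metric.ball (e p) r, inter_mem (e.open_source.mem_nhds hpe)
    (e.continuousAt hpe (Metric.ball_mem_nhds _ hr)), fun a ha b hb hab => ?_⟩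
  have hslice : IsPreconnected (Metric.ball (e p) r ∩ {z | l z = F a}) :=
    ((convex_ball _ _).inter (convex_hyperplane l.isLinear _)).isPreconnected
  refine ⟨e.symm '' (Metric.ball (e p) r ∩ {z | l z = F a}), ?_, hslice.image _ fun z hz => ?_,
    ⟨e a, ⟨ha.2, heF a⟩, e.left_inv ha.1⟩, ⟨e b, ⟨hb.2, (heF b).trans hab.symm⟩, e.left_inv hb.1⟩,
    ?_⟩
  · rintro _ ⟨z, hz, rfl⟩
    exact (hball z hz.1).2
  · exact (e.continuousAt_symm (hball z hz.1).1).continuousWithinAt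
  · rintro _ ⟨z, hz, rfl⟩
    rw [← heF, e.right_inv (hball z hz.1).1]
    exact hz.2

lemma eq_of_isPreconnected_of_eventually_eq {X Y : Type*} [TopologicalSpace X] {C : Set X}
    (hC : IsPreconnected C) {g : X → Y} (hg : ∀ y ∈ C, ∀ᶠ y' in 𝓝[C] y, g y' = g y) {a b : X}
    (ha : a ∈ C) (hb : b ∈ C) : g a = g b := by
  have : PreconnectedSpace C := isPreconnected_iff_preconnectedSpace.1 hC
  have hloc : IsLocallyConstant fun y : C => g y := (IsLocallyConstant.iff_eventually_eq _).2
    fun y => (eventually_nhds_subtype_iff C y fun y' => g y' = g y).2 (hg y y.2)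
  exact hloc.apply_eq_of_preconnectedSpace ⟨a, ha⟩ ⟨b, hb⟩

lemma exists_fderiv_eq_smul_of_eventually_eq (hF : ContDiffAt ℝ 1 F p)
    (hU : ContDiffAt ℝ 1 U p) (hp : fderiv ℝ F p ≠ 0) (h : ∀ᶠ y in 𝓝 p, F y = F p → U y = U p) :
    ∃ c : ℝ, fderiv ℝ U p = c • fderiv ℝ F p := by
  have hext : IsLocalExtrOn U {x | F x = F p} p :=
    Or.inl ((eventually_nhdsWithin_iff.2 h).mono fun y hy => hy.ge)
  obtain ⟨a, b, hab, h0⟩ := hext.exists_multipliers_of_hasStrictFDerivAt_1d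
    (hF.hasStrictFDerivAt (by simp)) (hU.hasStrictFDerivAt (by simp))
  have hb : b ≠ 0 := by
    rintro rfl
    simp_all
  refine ⟨-(b⁻¹ * a), ?_⟩
  rw [neg_smul, mul_smul, ← smul_neg, ← eq_neg_of_add_eq_zero_right h0, inv_smul_smul₀ hb]

lemma forall_eventually_eq_iff_exists_fderiv_eq_smul {W : Set E} (hW : IsOpen W)
    (hF : ContDiffOn ℝ 1 F W) (hU : ContDiffOn ℝ 1 U W) (hF' : ∀ x ∈ W, fderiv ℝ F x ≠ 0) :
    (∀ x ∈ W, ∀ᶠ y in 𝓝 x, F y = F x → U y = U x) ↔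
      ∀ x ∈ W, ∃ c : ℝ, fderiv ℝ U x = c • fderiv ℝ F x := by
  refine ⟨fun h x hx => exists_fderiv_eq_smul_of_eventually_eq (hF.contDiffAt (hW.mem_nhds hx))
    (hU.contDiffAt (hW.mem_nhds hx)) (hF' x hx) (h x hx), fun h x hx => ?_⟩
  obtain ⟨u, -, hUu⟩ := exists_eventuallyEq_comp_of_ker_fderiv_le one_ne_zero
    (hF.contDiffAt (hW.mem_nhds hx)) (hU.contDiffAt (hW.mem_nhds hx)) (hF' x hx)
    (by
      filter_upwards [hW.mem_nhds hx] with y hy v hv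
      obtain ⟨c, hc⟩ := h y hy
      simp [hc, hv])
  filter_upwards [hUu] with y hy hFy
  rw [hy, hUu.eq_of_nhds, Function.comp_apply, Function.comp_apply, hFy]

end FunctionalDependence

section Flow

variable {E : Type*} [NormedAddCommGroup E] [NormedSpace ℝ E]

lemma exists_forall_dist_lt_le_mul_of_isCompact {X : Type*} [PseudoMetricSpace X] {K : Set X}
    (hK : IsCompact K) {f g : X × X → ℝ} (hg : ∀ q, 0 ≤ g q)
    (h : ∀ p ∈ K, ∃ L : ℝ, 0 ≤ L ∧ ∀ᶠ q in 𝓝 (p, p), f q ≤ L * g q) :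
    ∃ L : ℝ, 0 ≤ L ∧ ∃ ρ > 0, ∀ p ∈ K, ∀ q, dist q p < ρ → f (q, p) ≤ L * g (q, p) := by
  refine hK.induction_on (p := fun K => ∃ L : ℝ, 0 ≤ L ∧ ∃ ρ > 0, ∀ p ∈ K, ∀ q,
    dist q p < ρ → f (q, p) ≤ L * g (q, p)) ⟨0, le_rfl, 1, one_pos, by simp⟩ ?_ ?_ ?_
  · rintro s t hst ⟨L, hL, ρ, hρ, H⟩
    exact ⟨L, hL, ρ, hρ, fun p hp => H p (hst hp)⟩
  · rintro s t ⟨L, hL, ρ, hρ, H⟩ ⟨L', -, ρ', hρ', H'⟩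
    refine ⟨max L L', le_max_of_le_left hL, min ρ ρ', lt_min hρ hρ', fun p hp q hq => ?_⟩
    rcases hp with hp | hp
    · exact (H p hp q (hq.trans_le (min_le_left _ _))).trans
        (mul_le_mul_of_nonneg_right (le_max_left _ _) (hg _))
    · exact (H' p hp q (hq.trans_le (min_le_right _ _))).trans
        (mul_le_mul_of_nonneg_right (le_max_right _ _) (hg _))
  · intro p hp
    obtain ⟨L, hL, H⟩ := h p hp
    obtain ⟨ε, hε, H⟩ := Metric.eventually_nhds_iff.1 H
    refine ⟨Metric.ball p (ε / 2), mem_nhdsWithin_of_mem_nhds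
      (Metric.ball_mem_nhds _ (half_pos hε)), L, hL, ε / 2, half_pos hε, fun a ha q hq => H ?_⟩
    rw [Metric.mem_ball] at ha
    exact max_lt (by linarith [dist_triangle q a p]) (by linarith)

lemma norm_sub_lt_of_hasDerivWithinAt {v : E → E} {T L ρ : ℝ} (hL : 0 ≤ L) {γ γ' : ℝ → E}
    (hγ : ∀ s ∈ Icc 0 T, HasDerivWithinAt γ (v (γ s)) (Icc 0 T) s)
    (hγ' : ∀ s ∈ Icc 0 T, HasDerivWithinAt γ' (v (γ' s)) (Icc 0 T) s)
    (hv : ∀ s ∈ Icc 0 T, ∀ q, ‖q - γ s‖ < ρ → ‖v q - v (γ s)‖ ≤ L * ‖q - γ s‖)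
    (h0 : ‖γ' 0 - γ 0‖ * Real.exp ((L + 1) * T) < ρ) :
    ∀ s ∈ Icc 0 T, ‖γ' s - γ s‖ < ρ := by
  have hd : ∀ s ∈ Icc 0 T,
      HasDerivWithinAt (fun s => γ' s - γ s) (v (γ' s) - v (γ s)) (Icc 0 T) s :=
    fun s hs => (hγ' s hs).sub (hγ s hs)
  obtain ⟨ε, hε0, hερ⟩ := exists_between ((lt_div_iff₀ (Real.exp_pos _)).2 h0)
  rw [lt_div_iff₀ (Real.exp_pos _)] at hερ
  have hε : 0 < ε := (norm_nonneg _).trans_lt hε0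
  -- The Lipschitz bound is only available in the tube of radius `ρ`, which the barrier `B` does not
  -- leave; the rate `L + 1` makes its growth strictly faster than that of `‖γ' - γ‖`.
  let B : ℝ → ℝ := fun s => ε * Real.exp ((L + 1) * s)
  have hB : ∀ s, HasDerivAt B ((L + 1) * B s) s := fun s => by
    refine (((hasDerivAt_id s).const_mul (L + 1)).exp.const_mul ε).congr_deriv ?_
    simp only [B, id_eq]
    ring
  have hBρ : ∀ s ∈ Icc 0 T, B s < ρ := fun s hs => lt_of_le_of_lt (by
    simp only [B]
    gcongr
    exact hs.2) hερ
  intro s hs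
  refine (image_norm_le_of_norm_deriv_right_lt_deriv_boundary
    (fun s hs => (hd s hs).continuousWithinAt) (fun s hs => (hd s
      (Ico_subset_Icc_self hs)).mono_of_mem_nhdsWithin (Icc_mem_nhdsGE_of_mem hs))
    (by simpa [B] using hε0.le) hB (fun s hs hsB => ?_) hs).trans_lt (hBρ s hs)
  have hs := Ico_subset_Icc_self hs
  calc ‖v (γ' s) - v (γ s)‖ ≤ L * B s := hsB ▸ hv s hs _ (hsB ▸ hBρ s hs)
    _ < (L + 1) * B s := by
      have : 0 < B s := mul_pos hε (Real.exp_pos _)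
      linarith

lemma eventually_forall_norm_sub_lt_of_hasDerivWithinAt {v : E → E} {W : Set E} (hW : IsOpen W)
    (hv : ContDiffOn ℝ 1 v W) {T : ℝ} {γ : ℝ → E} (hγW : ∀ s ∈ Icc 0 T, γ s ∈ W)
    (hγ : ∀ s ∈ Icc 0 T, HasDerivWithinAt γ (v (γ s)) (Icc 0 T) s) {ρ : ℝ} (hρ : 0 < ρ) :
    ∀ᶠ x in 𝓝 (γ 0), ∀ γ' : ℝ → E, γ' 0 = x →
      (∀ s ∈ Icc 0 T, HasDerivWithinAt γ' (v (γ' s)) (Icc 0 T) s) →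
      ∀ s ∈ Icc 0 T, ‖γ' s - γ s‖ < ρ := by
  have hK : IsCompact (γ '' Icc 0 T) :=
    isCompact_Icc.image_of_continuousOn fun s hs => (hγ s hs).continuousWithinAt
  obtain ⟨L, hL, σ, hσ, hLσ⟩ := exists_forall_dist_lt_le_mul_of_isCompact hK
    (f := fun q => ‖v q.1 - v q.2‖) (g := fun q => ‖q.1 - q.2‖) (fun _ => norm_nonneg _) (by
      rintro _ ⟨s, hs, rfl⟩
      obtain ⟨L, t, ht, hlip⟩ := (hv.contDiffAt (hW.mem_nhds (hγW s hs))).exists_lipschitzOnWith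
      refine ⟨L, L.2, ?_⟩
      filter_upwards [prod_mem_nhds ht ht] with q hq
      simpa [dist_eq_norm] using hlip.dist_le_mul _ hq.1 _ hq.2)
  have hmin : 0 < min σ ρ := lt_min hσ hρ
  have hclose : ∀ᶠ x in 𝓝 (γ 0), ‖x - γ 0‖ * Real.exp ((L + 1) * T) < min σ ρ :=
    ContinuousAt.eventually_lt (by fun_prop) continuousAt_const (by simpa using hmin)
  filter_upwards [hclose] with x hx γ' hγ'0 hγ' s hs
  refine (norm_sub_lt_of_hasDerivWithinAt hL hγ hγ' (fun s hs q hq => ?_)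
    (hγ'0 ▸ hx) s hs).trans_le (min_le_right _ _)
  exact hLσ _ (mem_image_of_mem _ hs) q
    (by simpa [dist_eq_norm] using hq.trans_le (min_le_left _ _))

lemma exists_local_flow [CompleteSpace E] {v : E → E} {W : Set E} (hW : IsOpen W)
    (hv : ContDiffOn ℝ 1 v W) {p : E} (hp : p ∈ W) :
    ∃ α : E → ℝ → E, ∃ η > 0, ∀ x ∈ Metric.ball p η, α x 0 = x ∧
      ∀ t ∈ Metric.ball 0 η, α x t ∈ W ∧ HasDerivAt (α x) (v (α x t)) t := by
  obtain ⟨ε, hε, a, r, L, K, hr, hpl⟩ :=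
    IsPicardLindelof.of_contDiffAt_one (hv.contDiffAt (hW.mem_nhds hp))
  obtain ⟨α, hα, hαc⟩ := (hpl 0).exists_forall_mem_closedBall_eq_hasDerivWithinAt_continuousOn
  have hI : ∀ t ∈ Ioo (0 - ε) (0 + ε), Icc (0 - ε) (0 + ε) ∈ 𝓝 t :=
    fun t ht => Icc_mem_nhds ht.1 ht.2
  have hα0 : ∀ x ∈ Metric.closedBall p r, α (x, 0) = x := fun x hx => (hα x hx).1
  have h0 : (0 : ℝ) ∈ Ioo (0 - ε) (0 + ε) := by simpa using hε
  have hball : Metric.closedBall p r ∈ 𝓝 p := Metric.closedBall_mem_nhds p hr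
  have hαW : ∀ᶠ q in 𝓝 (p, (0 : ℝ)), α q ∈ W :=
    (hαc.continuousAt (prod_mem_nhds hball (hI 0 h0))).eventually
      (by simpa [hα0 p (mem_of_mem_nhds hball)] using hW.mem_nhds hp)
  obtain ⟨η, hη, hηα⟩ := Metric.eventually_nhds_iff_ball.1
    (hαW.and (prod_mem_nhds hball (isOpen_Ioo.mem_nhds h0)))
  have hmem : ∀ x ∈ Metric.ball p η, ∀ t ∈ Metric.ball (0 : ℝ) η,
      (x, t) ∈ Metric.ball (p, (0 : ℝ)) η := fun x hx t ht => by
    rw [← ball_prod_same]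
    exact ⟨hx, ht⟩
  refine ⟨fun x t => α (x, t), η, hη, fun x hx => ?_⟩
  have hx' := (hηα _ (hmem x hx 0 (Metric.mem_ball_self hη))).2.1
  refine ⟨hα0 x hx', fun t ht => ?_⟩
  obtain ⟨htW, -, ht'⟩ := hηα _ (hmem x hx t ht)
  exact ⟨htW, ((hα x hx').2 t (Ioo_subset_Icc_self ht')).hasDerivAt (hI t ht')⟩

variable {n : ℕ} {F : Space n → ℝ} {W : Set (Space n)} {N : Space n → Space n}

lemma FlowsTo.exists_hasDerivWithinAt {t : ℝ} {x y : Space n} (h : FlowsTo W N t x y) :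
    ∃ γ : ℝ → Space n, γ 0 = x ∧ γ 1 = y ∧ (∀ s ∈ Icc (0 : ℝ) 1, γ s ∈ W) ∧
      ∀ s ∈ Icc (0 : ℝ) 1, HasDerivWithinAt γ (t • N (γ s)) (Icc 0 1) s := by
  obtain ⟨γ, h0, ht, hW, hγ⟩ := h
  have hmaps : MapsTo (fun s : ℝ => t * s) (Icc 0 1) (uIcc 0 t) := fun s hs => by
    simpa [segment_eq_uIcc, AffineMap.lineMap_apply, mul_comm] using
      lineMap_mem_segment ℝ (0 : ℝ) t hs
  refine ⟨fun s => γ (t * s), by simpa using h0, by simpa using ht,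
    fun s hs => hW _ (hmaps hs), fun s hs => ?_⟩
  have hmul : HasDerivWithinAt (fun s : ℝ => t * s) t (Icc 0 1) s := by
    simpa using (hasDerivWithinAt_id s (Icc (0 : ℝ) 1)).const_mul t
  exact (hγ _ (hmaps hs)).scomp s hmul hmaps

lemma hasDerivWithinAt_comp_of_smul (hW : IsOpen W)
    (hF : DifferentiableOn ℝ F W) {γ : ℝ → Space n} {t s : ℝ} {I : Set ℝ} (hs : γ s ∈ W)
    (hγ : HasDerivWithinAt γ (t • N (γ s)) I s) :
    HasDerivWithinAt (F ∘ γ) (t * fderiv ℝ F (γ s) (N (γ s))) I s := by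
  simpa using ((hF.differentiableAt (hW.mem_nhds hs)).hasFDerivAt).comp_hasDerivWithinAt s hγ

lemma flowPreservesLevelSets_of_abs_sub_le (hW : IsOpen W) (hN : ContDiffOn ℝ 1 N W)
    (hF : DifferentiableOn ℝ F W)
    (hFN : ∀ p ∈ W, ∃ L : ℝ, 0 ≤ L ∧ ∀ᶠ q in 𝓝 (p, p),
      |fderiv ℝ F q.1 (N q.1) - fderiv ℝ F q.2 (N q.2)| ≤ L * |F q.1 - F q.2|) :
    FlowPreservesLevelSets F W N := by
  intro t x y hxy
  obtain ⟨γ, rfl, rfl, hγW, hγ⟩ := hxy.exists_hasDerivWithinAt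
  have hK : IsCompact (γ '' Icc 0 1) :=
    isCompact_Icc.image_of_continuousOn fun s hs => (hγ s hs).continuousWithinAt
  obtain ⟨L, -, ρ, hρ, hLρ⟩ := exists_forall_dist_lt_le_mul_of_isCompact hK
    (f := fun q => |fderiv ℝ F q.1 (N q.1) - fderiv ℝ F q.2 (N q.2)|)
    (g := fun q => |F q.1 - F q.2|) (fun _ => abs_nonneg _)
    (by
      rintro _ ⟨s, hs, rfl⟩
      exact hFN _ (hγW s hs))
  filter_upwards [eventually_forall_norm_sub_lt_of_hasDerivWithinAt (v := fun z => t • N z) hW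
    (hN.const_smul t) hγW hγ hρ] with x' htube hFx y' hy'
  obtain ⟨γ', rfl, rfl, hγW', hγ'⟩ := hy'.exists_hasDerivWithinAt
  have hd : ∀ s ∈ Icc (0 : ℝ) 1, HasDerivWithinAt (F ∘ γ' - F ∘ γ)
      (t * (fderiv ℝ F (γ' s) (N (γ' s)) - fderiv ℝ F (γ s) (N (γ s)))) (Icc 0 1) s :=
    fun s hs => ((hasDerivWithinAt_comp_of_smul hW hF (hγW' s hs) (hγ' s hs)).sub
      (hasDerivWithinAt_comp_of_smul hW hF (hγW s hs) (hγ s hs))).congr_deriv (mul_sub _ _ _).symm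
  -- Two integral curves starting on one level of `F`: Grönwall's inequality for the difference of
  -- the values of `F` along them.
  refine sub_eq_zero.1 (eq_zero_of_abs_deriv_le_mul_abs_self_of_eq_zero_right (K := |t| * L)
    (fun s hs => (hd s hs).continuousWithinAt) (fun s hs => (hd s
      (Ico_subset_Icc_self hs)).mono_of_mem_nhdsWithin (Icc_mem_nhdsGE_of_mem hs))
    (sub_eq_zero.2 hFx) (fun s hs => ?_) 1 ⟨zero_le_one, le_rfl⟩)
  have hs := Ico_subset_Icc_self hs
  rw [norm_mul, mul_assoc]
  exact mul_le_mul_of_nonneg_left (hLρ _ (mem_image_of_mem _ hs) _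
    (by simpa [dist_eq_norm] using htube γ' rfl hγ' s hs)) (abs_nonneg t)

lemma FlowPreservesLevelSets.eventually_fderiv_apply_eq (h : FlowPreservesLevelSets F W N)
    (hW : IsOpen W) (hN : ContDiffOn ℝ 1 N W) (hF : ContDiffOn ℝ 1 F W) {p : Space n}
    (hp : p ∈ W) (hFp : fderiv ℝ F p ≠ 0) :
    ∀ᶠ x in 𝓝 p, F x = F p → fderiv ℝ F x (N x) = fderiv ℝ F p (N p) := by
  obtain ⟨α, η, hη, hα⟩ := exists_local_flow hW hN hp
  have hflow : ∀ x ∈ Metric.ball p η, ∀ t ∈ Metric.ball (0 : ℝ) η, FlowsTo W N t x (α x t) := by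
    intro x hx t ht
    have hsub : uIcc 0 t ⊆ Metric.ball 0 η := by
      rw [← segment_eq_uIcc]
      exact (convex_ball (0 : ℝ) η).segment_subset (Metric.mem_ball_self hη) ht
    exact ⟨α x, (hα x hx).1, rfl, fun s hs => ((hα x hx).2 s (hsub hs)).1,
      fun s hs => ((hα x hx).2 s (hsub hs)).2.hasDerivWithinAt⟩
  have hderiv : ∀ x ∈ Metric.ball p η,
      HasDerivAt (fun t => F (α x t)) (fderiv ℝ F x (N x)) 0 := by
    intro x hx
    obtain ⟨hx0, hxα⟩ := hα x hx
    obtain ⟨hxW, hx'⟩ := hxα 0 (Metric.mem_ball_self hη)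
    have hFx := ((hF.differentiableOn one_ne_zero).differentiableAt (hW.mem_nhds hxW)).hasFDerivAt
    have hcomp : HasDerivAt (F ∘ α x) (fderiv ℝ F (α x 0) (N (α x 0))) 0 :=
      hFx.comp_hasDerivAt 0 hx'
    rwa [hx0] at hcomp
  obtain ⟨V, hV, hVC⟩ := exists_mem_nhds_exists_isPreconnected_level
    (hF.contDiffAt (hW.mem_nhds hp)) hFp (Metric.ball_mem_nhds p hη)
  filter_upwards [Metric.ball_mem_nhds p hη, hV] with x hx hxV hFx
  refine (hderiv x hx).unique ((hderiv p (Metric.mem_ball_self hη)).congr_of_eventuallyEq ?_)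
  filter_upwards [Metric.ball_mem_nhds (0 : ℝ) hη] with t ht
  obtain ⟨C, hCη, hC, hxC, hpC, hFC⟩ := hVC x hxV p (mem_of_mem_nhds hV) hFx
  refine eq_of_isPreconnected_of_eventually_eq hC (g := fun z => F (α z t)) (fun y hy => ?_) hxC hpC
  filter_upwards [mem_nhdsWithin_of_mem_nhds (h t y _ (hflow y (hCη hy) t ht)),
    self_mem_nhdsWithin] with y' hy' hy'C
  exact hy' ((hFC y' hy'C).trans (hFC y hy).symm) _ (hflow y' (hCη hy'C) t ht)

lemma flowPreservesLevelSets_iff (hW : IsOpen W) (hN : ContDiffOn ℝ 1 N W)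
    (hF : ContDiffOn ℝ 1 F W) (hF' : ∀ x ∈ W, fderiv ℝ F x ≠ 0)
    (hFN : ContDiffOn ℝ 1 (fun x => fderiv ℝ F x (N x)) W) :
    FlowPreservesLevelSets F W N ↔
      ∀ x ∈ W, ∃ c : ℝ, fderiv ℝ (fun x => fderiv ℝ F x (N x)) x = c • fderiv ℝ F x := by
  refine ⟨fun h => (forall_eventually_eq_iff_exists_fderiv_eq_smul hW hF hFN hF').1 fun x hx =>
    h.eventually_fderiv_apply_eq hW hN hF hx (hF' x hx), fun h => ?_⟩
  refine flowPreservesLevelSets_of_abs_sub_le hW hN (hF.differentiableOn one_ne_zero) fun p hp =>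
    exists_abs_sub_le_of_ker_fderiv_le (hF.contDiffAt (hW.mem_nhds hp))
      (hFN.contDiffAt (hW.mem_nhds hp)) (hF' p hp) ?_
  filter_upwards [hW.mem_nhds hp] with y hy v hv
  obtain ⟨c, hc⟩ := h y hy
  simp [hc, hv]

end Flow

section MatrixCalculus

variable {𝕜 E ι : Type*} [NontriviallyNormedField 𝕜] [NormedAddCommGroup E] [NormedSpace 𝕜 E]
  [Fintype ι] [DecidableEq ι] {A : E → Matrix ι ι 𝕜} {x : E}

lemma contDiffAt_det {k : ℕ∞ω} (hA : ∀ i j, ContDiffAt 𝕜 k (fun y => A y i j) x) :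
    ContDiffAt 𝕜 k (fun y => (A y).det) x := by
  simp only [Matrix.det_apply']
  exact ContDiffAt.sum fun σ _ => contDiffAt_const.mul (contDiffAt_prod fun i _ => hA _ _)

lemma contDiffAt_adjugate {k : ℕ∞ω} (hA : ∀ i j, ContDiffAt 𝕜 k (fun y => A y i j) x) (i j : ι) :
    ContDiffAt 𝕜 k (fun y => (A y).adjugate i j) x := by
  simp only [Matrix.adjugate_apply]
  refine contDiffAt_det fun a b => ?_
  simp only [Matrix.updateRow_apply]
  split_ifs
  · exact contDiffAt_const
  · exact hA a b

lemma contDiffAt_matrix_inv {k : ℕ∞ω} (hA : ∀ i j, ContDiffAt 𝕜 k (fun y => A y i j) x)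
    (hx : (A x).det ≠ 0) (i j : ι) : ContDiffAt 𝕜 k (fun y => (A y)⁻¹ i j) x := by
  simp only [Matrix.inv_def, Matrix.smul_apply, smul_eq_mul, Ring.inverse_eq_inv']
  exact ((contDiffAt_det hA).inv hx).mul (contDiffAt_adjugate hA i j)

lemma adjugate_eq_det_smul_inv {M : Matrix ι ι 𝕜} (hM : M.det ≠ 0) :
    M.adjugate = M.det • M⁻¹ := by
  rw [Matrix.inv_def, smul_smul, Ring.mul_inverse_cancel _ (isUnit_iff_ne_zero.2 hM), one_smul]

lemma trace_adjugate_mul {R : Type*} [CommRing R] (M B : Matrix ι ι R) :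
    (M.adjugate * B).trace = ∑ i, (M.updateRow i (B.row i)).det := by
  rw [Matrix.trace_mul_comm]
  refine Finset.sum_congr rfl fun i _ => ?_
  rw [← Matrix.cramer_transpose_apply, Matrix.cramer_eq_adjugate_mulVec,
    ← Matrix.adjugate_transpose, Matrix.mulVec_transpose]
  rfl

lemma fderiv_det_apply (hA : ∀ i j, DifferentiableAt 𝕜 (fun y => A y i j) x) (v : E) :
    fderiv 𝕜 (fun y => (A y).det) x v =
      ((A x).adjugate * Matrix.of fun i j => fderiv 𝕜 (fun y => A y i j) x v).trace := by
  let det : ContinuousMultilinearMap 𝕜 (fun _ : ι => ι → 𝕜) 𝕜 :=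
    { Matrix.detRowAlternating.toMultilinearMap with cont := Continuous.matrix_det continuous_id }
  have hrows : HasFDerivAt (fun y i j => A y i j) (ContinuousLinearMap.pi fun i =>
      ContinuousLinearMap.pi fun j => fderiv 𝕜 (fun y => A y i j) x) x :=
    hasFDerivAt_pi.2 fun i => hasFDerivAt_pi.2 fun j => (hA i j).hasFDerivAt
  have hdet : HasFDerivAt (fun y => (A y).det) _ x := (det.hasFDerivAt (A x)).comp x hrows
  rw [hdet.fderiv, trace_adjugate_mul]
  exact det.linearDeriv_apply _ _

end MatrixCalculus

section Hessian

variable {n : ℕ} {F : Space n → ℝ} {x : Space n}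

lemma sum_smul_basisVec (v : Space n) : ∑ i, v i • basisVec i = v :=
  (pi_eq_sum_univ' v).symm

lemma apply_eq_sum_basisVec {M : Type*} [AddCommGroup M] [Module ℝ M] [TopologicalSpace M]
    (l : Space n →L[ℝ] M) (v : Space n) : l v = ∑ i, v i • l (basisVec i) := by
  conv_lhs => rw [← sum_smul_basisVec v]
  simp

lemma trace_eq_sum_basisVec (L : Space n →ₗ[ℝ] Space n) :
    LinearMap.trace ℝ (Space n) L = ∑ i, L (basisVec i) i := by
  rw [LinearMap.trace_eq_matrix_trace ℝ (Pi.basisFun ℝ (Fin (n + 1)))]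
  simp [Matrix.trace, basisVec]

/-- The Hessian as a bilinear form. -/
noncomputable abbrev hessForm (F : Space n → ℝ) (x : Space n) :
    Space n →L[ℝ] Space n →L[ℝ] ℝ :=
  fderiv ℝ (fderiv ℝ F) x

/-- The third derivative as a trilinear form; its first argument is the direction in which the
Hessian is differentiated. -/
noncomputable abbrev thirdForm (F : Space n → ℝ) (x : Space n) :
    Space n →L[ℝ] Space n →L[ℝ] Space n →L[ℝ] ℝ :=
  fderiv ℝ (hessForm F) x

/-- The vector dual to a one-form with respect to the Hessian. -/
noncomputable def sharp (F : Space n → ℝ) (x : Space n) : (Space n →L[ℝ] ℝ) →ₗ[ℝ] Space n where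
  toFun α := (hess F x)⁻¹.mulVec fun i => α (basisVec i)
  map_add' _ _ := Matrix.mulVec_add _ _ _
  map_smul' c α := Matrix.mulVec_smul _ c fun i => α (basisVec i)

lemma sharp_apply (α : Space n →L[ℝ] ℝ) :
    sharp F x α = (hess F x)⁻¹.mulVec fun i => α (basisVec i) := rfl

lemma sharp_fderiv : sharp F x (fderiv ℝ F x) = hessGrad F x := rfl

lemma differentiableAt_fderiv (hF : ContDiffAt ℝ 2 F x) : DifferentiableAt ℝ (fderiv ℝ F) x :=
  (hF.fderiv_right (m := 1) (by norm_num)).differentiableAt (by norm_num)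

lemma differentiableAt_hessForm (hF : ContDiffAt ℝ 3 F x) :
    DifferentiableAt ℝ (hessForm F) x :=
  ((hF.fderiv_right (m := 2) (by norm_num)).fderiv_right (m := 1) (by norm_num)).differentiableAt
    (by norm_num)

lemma fderiv_pd_apply (hF : ContDiffAt ℝ 2 F x) (i : Fin (n + 1)) (v : Space n) :
    fderiv ℝ (pd i F) x v = hessForm F x v (basisVec i) := by
  have h : HasFDerivAt (pd i F) _ x :=
    (differentiableAt_fderiv hF).hasFDerivAt.clm_apply (hasFDerivAt_const (basisVec i) x)
  simp [h.fderiv]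

lemma hess_apply (hF : ContDiffAt ℝ 2 F x) (i j : Fin (n + 1)) :
    hess F x i j = hessForm F x (basisVec i) (basisVec j) :=
  fderiv_pd_apply hF j _

lemma hessForm_apply (hF : ContDiffAt ℝ 2 F x) (u v : Space n) :
    hessForm F x u v = u ⬝ᵥ (hess F x).mulVec v := by
  rw [apply_eq_sum_basisVec (hessForm F x) u, sum_apply]
  refine Finset.sum_congr rfl fun i _ => ?_
  rw [smul_apply, apply_eq_sum_basisVec, smul_eq_mul, Matrix.mulVec]
  congr 1
  refine Finset.sum_congr rfl fun j _ => ?_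
  dsimp only
  rw [hess_apply hF, smul_eq_mul, mul_comm]

lemma hessForm_comm (hF : ContDiffAt ℝ 2 F x) (u v : Space n) :
    hessForm F x u v = hessForm F x v u :=
  hF.isSymmSndFDerivAt (by simp [minSmoothness_of_isRCLikeNormedField]) u v

lemma hess_isSymm (hF : ContDiffAt ℝ 2 F x) : (hess F x).IsSymm :=
  Matrix.IsSymm.ext fun i j => by rw [hess_apply hF, hess_apply hF, hessForm_comm hF]

lemma inv_hess_isSymm (hF : ContDiffAt ℝ 2 F x) : (hess F x)⁻¹.IsSymm := by
  rw [Matrix.IsSymm, Matrix.transpose_nonsing_inv, hess_isSymm hF]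

lemma thirdForm_comm (hF : ContDiffAt ℝ 3 F x) (u v : Space n) :
    thirdForm F x u v = thirdForm F x v u :=
  (hF.fderiv_right (m := 2) (by norm_num)).isSymmSndFDerivAt
    (by simp [minSmoothness_of_isRCLikeNormedField]) u v

lemma fderiv_hess_apply (hF : ContDiffAt ℝ 3 F x) (i j : Fin (n + 1)) (v : Space n) :
    fderiv ℝ (fun y => hess F y i j) x v = thirdForm F x v (basisVec i) (basisVec j) := by
  have hhess : (fun y => hess F y i j) =ᶠ[𝓝 x] fun y => hessForm F y (basisVec i) (basisVec j) := by
    filter_upwards [(hF.of_le (m := 2) (by norm_num)).eventually (by simp)] with y hy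
    exact hess_apply hy i j
  have h : HasFDerivAt (fun y => hessForm F y (basisVec i) (basisVec j)) _ x :=
    ((differentiableAt_hessForm hF).hasFDerivAt.clm_apply (hasFDerivAt_const _ x)).clm_apply
      (hasFDerivAt_const _ x)
  rw [hhess.fderiv_eq, h.fderiv]
  simp

lemma third_apply (hF : ContDiffAt ℝ 3 F x) (i j k : Fin (n + 1)) :
    third F x i j k = thirdForm F x (basisVec i) (basisVec j) (basisVec k) :=
  fderiv_hess_apply hF j k _

lemma hessForm_sharp (hF : ContDiffAt ℝ 2 F x) (hx : (hess F x).det ≠ 0)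
    (α : Space n →L[ℝ] ℝ) : hessForm F x (sharp F x α) = α := by
  ext v
  rw [hessForm_comm hF, hessForm_apply hF, sharp_apply, Matrix.mulVec_mulVec,
    Matrix.mul_nonsing_inv _ (isUnit_iff_ne_zero.2 hx), Matrix.one_mulVec,
    apply_eq_sum_basisVec α v]
  rfl

lemma sharp_hessForm (hF : ContDiffAt ℝ 2 F x) (hx : (hess F x).det ≠ 0) (v : Space n) :
    sharp F x (hessForm F x v) = v := by
  have h : (fun i => hessForm F x v (basisVec i)) = (hess F x).mulVec v := by
    ext i
    simp [hessForm_comm hF v, hessForm_apply hF, basisVec]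
  rw [sharp_apply, h, Matrix.mulVec_mulVec, Matrix.nonsing_inv_mul _ (isUnit_iff_ne_zero.2 hx),
    Matrix.one_mulVec]

lemma hessForm_hessGrad (hF : ContDiffAt ℝ 2 F x) (hx : (hess F x).det ≠ 0) :
    hessForm F x (hessGrad F x) = fderiv ℝ F x :=
  hessForm_sharp hF hx _

lemma fderiv_apply_sharp (hF : ContDiffAt ℝ 2 F x) (hx : (hess F x).det ≠ 0)
    (α : Space n →L[ℝ] ℝ) : fderiv ℝ F x (sharp F x α) = α (hessGrad F x) := by
  rw [← hessForm_hessGrad hF hx, hessForm_comm hF, hessForm_sharp hF hx]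

section Regularity

variable {Ψ : VolForm n} {k : ℕ∞ω}

lemma contDiffAt_pd (hF : ContDiffAt ℝ (k + 1) F x) (i : Fin (n + 1)) :
    ContDiffAt ℝ k (pd i F) x :=
  (hF.fderiv_right le_rfl).clm_apply contDiffAt_const

lemma contDiffAt_hess (hF : ContDiffAt ℝ (k + 2) F x) (i j : Fin (n + 1)) :
    ContDiffAt ℝ k (fun y => hess F y i j) x := by
  rw [← one_add_one_eq_two, ← add_assoc] at hF
  exact contDiffAt_pd (contDiffAt_pd hF j) i

lemma contDiffAt_hessDet (hF : ContDiffAt ℝ (k + 2) F x) : ContDiffAt ℝ k (hessDet Ψ F) x :=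
  (contDiffAt_det (contDiffAt_hess hF)).div_const _

lemma contDiffAt_uFun (hF : ContDiffAt ℝ (k + 2) F x) : ContDiffAt ℝ k (uFun Ψ F) x := by
  have hgrad (i) : ContDiffAt ℝ k (pd i F) x :=
    contDiffAt_pd (hF.of_le (add_le_add_right one_le_two k)) i
  refine ContDiffAt.sum fun i _ => ContDiffAt.sum fun j _ => ?_
  refine (ContDiffAt.mul ?_ (hgrad i)).mul (hgrad j)
  exact contDiffAt_const.mul (contDiffAt_adjugate (contDiffAt_hess hF) i j)

lemma contDiffAt_sharp (hF : ContDiffAt ℝ (k + 2) F x) (hx : (hess F x).det ≠ 0)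
    {α : Space n → Space n →L[ℝ] ℝ} (hα : ContDiffAt ℝ k α x) :
    ContDiffAt ℝ k (fun y => sharp F y (α y)) x := by
  refine contDiffAt_pi.2 fun i => ?_
  simp only [sharp_apply, Matrix.mulVec, dotProduct]
  exact ContDiffAt.sum fun j _ => (contDiffAt_matrix_inv (contDiffAt_hess hF) hx i j).mul
    (hα.clm_apply contDiffAt_const)

lemma contDiffAt_hessGrad (hF : ContDiffAt ℝ (k + 2) F x) (hx : (hess F x).det ≠ 0) :
    ContDiffAt ℝ k (hessGrad F) x :=
  contDiffAt_sharp hF hx (hF.fderiv_right (add_le_add_right one_le_two k))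

end Regularity

lemma fderiv_fderiv_apply (hF : ContDiffAt ℝ 2 F x) {Y : Space n → Space n}
    (hY : DifferentiableAt ℝ Y x) (v : Space n) :
    fderiv ℝ (fun y => fderiv ℝ F y (Y y)) x v =
      hessForm F x v (Y x) + fderiv ℝ F x (fderiv ℝ Y x v) := by
  have h := (differentiableAt_fderiv hF).hasFDerivAt.clm_apply hY.hasFDerivAt
  simp [h.fderiv, add_comm]

lemma fderiv_hessGrad_apply (hF : ContDiffAt ℝ 3 F x) (hx : (hess F x).det ≠ 0) (v : Space n) :
    fderiv ℝ (hessGrad F) x v = v - sharp F x (thirdForm F x v (hessGrad F x)) := by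
  have hF2 : ContDiffAt ℝ 2 F x := hF.of_le (by norm_num)
  have hF12 : ContDiffAt ℝ (1 + 2) F x := by norm_num [hF]
  -- Differentiate the identity `g(F^i, ·) = dF`.
  have hdual : (fun y => hessForm F y (hessGrad F y)) =ᶠ[𝓝 x] fderiv ℝ F := by
    filter_upwards [hF2.eventually (by simp),
      (contDiffAt_det (contDiffAt_hess hF12)).continuousAt.eventually_ne hx] with y hy hdet
    exact hessForm_hessGrad hy hdet
  have hderiv := (differentiableAt_hessForm hF).hasFDerivAt.clm_apply
    ((contDiffAt_hessGrad hF12 hx).differentiableAt (by norm_num)).hasFDerivAt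
  have h : hessForm F x (fderiv ℝ (hessGrad F) x v) + thirdForm F x v (hessGrad F x) =
      hessForm F x v := by
    simpa using congrArg (· v) (hderiv.fderiv.symm.trans hdual.fderiv_eq)
  rw [eq_sub_iff_add_eq, ← sharp_hessForm hF2 hx (fderiv ℝ (hessGrad F) x v), ← map_add, h,
    sharp_hessForm hF2 hx]

variable {Ψ : VolForm n}

lemma det_hess_ne_zero (hH : hessDet Ψ F x ≠ 0) : (hess F x).det ≠ 0 :=
  fun h => hH (by simp [hessDet, h])

lemma uFun_eq (hH : hessDet Ψ F x ≠ 0) :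
    uFun Ψ F x = hessDet Ψ F x * fderiv ℝ F x (hessGrad F x) := by
  rw [apply_eq_sum_basisVec]
  simp only [uFun, adjHess, adjugate_eq_det_smul_inv (det_hess_ne_zero hH), hessGrad, hessDet,
    Matrix.smul_apply, smul_eq_mul, Finset.mul_sum, Finset.sum_mul]
  refine Finset.sum_congr rfl fun i _ => Finset.sum_congr rfl fun j _ => ?_
  rw [grad, grad, pd]
  ring

lemma fderiv_apply_hessGrad (hH : hessDet Ψ F x ≠ 0) :
    fderiv ℝ F x (hessGrad F x) = uFun Ψ F x * (hessDet Ψ F x)⁻¹ := by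
  rw [uFun_eq hH]
  field_simp

lemma fderiv_ne_zero (hH : hessDet Ψ F x ≠ 0) (hU : uFun Ψ F x ≠ 0) : fderiv ℝ F x ≠ 0 := by
  intro h
  exact hU (by rw [uFun_eq hH, h, zero_apply, mul_zero])

lemma fderiv_hessDet_apply (hF : ContDiffAt ℝ 3 F x) (hx : (hess F x).det ≠ 0) (v : Space n) :
    fderiv ℝ (hessDet Ψ F) x v = hessDet Ψ F x *
      LinearMap.trace ℝ (Space n) (sharp F x ∘ₗ (thirdForm F x v).toLinearMap) := by
  have hF12 : ContDiffAt ℝ (1 + 2) F x := by norm_num [hF]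
  have hF2 : ContDiffAt ℝ 2 F x := hF.of_le (by norm_num)
  have hd (i j) : DifferentiableAt ℝ (fun y => hess F y i j) x :=
    (contDiffAt_hess hF12 i j).differentiableAt (by norm_num)
  have hjacobi : fderiv ℝ (hessDet Ψ F) x v = hessDet Ψ F x *
      ((hess F x)⁻¹ * Matrix.of fun i j => fderiv ℝ (fun y => hess F y i j) x v).trace := by
    have hΨ : hessDet Ψ F = fun y => ((Ψ basisVec) ^ 2)⁻¹ • (hess F y).det :=
      funext fun y => div_eq_inv_mul _ _
    rw [hΨ, fderiv_fun_const_smul ((contDiffAt_det (contDiffAt_hess hF12)).differentiableAt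
      (by norm_num)), smul_apply, fderiv_det_apply hd, adjugate_eq_det_smul_inv hx,
      Matrix.smul_mul, Matrix.trace_smul, smul_eq_mul, smul_eq_mul]
    exact (mul_assoc _ _ _).symm
  rw [hjacobi, trace_eq_sum_basisVec, Matrix.trace_mul_comm]
  congr 1
  refine Finset.sum_congr rfl fun i _ => ?_
  rw [Matrix.diag_apply, Matrix.mul_apply, LinearMap.comp_apply, sharp_apply]
  refine Finset.sum_congr rfl fun j _ => ?_
  rw [Matrix.of_apply, fderiv_hess_apply hF, (inv_hess_isSymm hF2).apply i j, mul_comm]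
  rfl

end Hessian

section PowerOfU

variable {n : ℕ} {Ψ : VolForm n} {F : Space n → ℝ} {x : Space n}

/-- The function `|U(F)|^{1/(n+2)}`, which is `-dF(N)` for the equiaffine normal `N`. -/
noncomputable def uPow (Ψ : VolForm n) (F : Space n → ℝ) (x : Space n) : ℝ :=
  |uFun Ψ F x| ^ (1 / ((n : ℝ) + 2))

lemma uPow_pos (hU : uFun Ψ F x ≠ 0) : 0 < uPow Ψ F x :=
  Real.rpow_pos_of_pos (abs_pos.2 hU) _

lemma uPow_pow : uPow Ψ F x ^ (n + 2) = |uFun Ψ F x| := by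
  have h := Real.rpow_inv_natCast_pow (abs_nonneg (uFun Ψ F x)) (n := n + 2) (by simp)
  rw [uPow, one_div]
  exact_mod_cast h

lemma conormal_eq : conormal Ψ F x = (-(uPow Ψ F x)⁻¹) • fderiv ℝ F x := by
  rw [conormal, uPow, Real.rpow_neg (abs_nonneg _)]

lemma real_sign_eq_coe_sign (a : ℝ) : Real.sign a = SignType.sign a := by
  rcases lt_trichotomy a 0 with ha | rfl | ha
  · rw [Real.sign_of_neg ha, sign_neg ha, SignType.coe_neg_one]
  · simp
  · rw [Real.sign_of_pos ha, sign_pos ha, SignType.coe_one]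

lemma real_sign_mul_inv_abs (a : ℝ) : Real.sign a * |a|⁻¹ = a⁻¹ := by
  rw [← abs_inv, ← Real.sign_inv, real_sign_eq_coe_sign, sign_mul_abs]

lemma normalFactor_eq (hU : uFun Ψ F x ≠ 0) :
    normalFactor Ψ F x = uPow Ψ F x * hessDet Ψ F x * (uFun Ψ F x)⁻¹ := by
  have hexp : -(((n : ℝ) + 1) / ((n : ℝ) + 2)) = 1 / ((n : ℝ) + 2) - 1 := by
    field_simp
    ring
  rw [normalFactor, hexp, Real.rpow_sub_one (abs_ne_zero.2 hU),
    ← real_sign_mul_inv_abs (uFun Ψ F x), uPow]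
  ring

lemma contDiffAt_uPow {k : ℕ∞} (hF : ContDiffAt ℝ (k + 2) F x) (hU : uFun Ψ F x ≠ 0) :
    ContDiffAt ℝ k (uPow Ψ F) x :=
  ((contDiffAt_uFun hF).abs hU).rpow_const_of_ne (abs_ne_zero.2 hU)

lemma fderiv_uFun (hU : uFun Ψ F x ≠ 0) :
    fderiv ℝ (uFun Ψ F) x = (((n : ℝ) + 2) * uFun Ψ F x) • muForm Ψ F x := by
  rw [muForm, smul_smul]
  field_simp
  rw [one_smul]

lemma fderiv_uPow (hF : ContDiffAt ℝ 3 F x) (hU : uFun Ψ F x ≠ 0) :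
    fderiv ℝ (uPow Ψ F) x = uPow Ψ F x • muForm Ψ F x := by
  have hF12 : ContDiffAt ℝ (1 + 2) F x := by norm_num [hF]
  have hpow := ((hasDerivAt_abs hU).comp_hasFDerivAt x
    ((contDiffAt_uFun (Ψ := Ψ) hF12).differentiableAt one_ne_zero).hasFDerivAt).rpow_const
      (p := 1 / ((n : ℝ) + 2)) (Or.inl (abs_ne_zero.2 hU))
  refine hpow.fderiv.trans ?_
  ext v
  simp only [muForm, smul_apply, smul_eq_mul, Function.comp_apply, ← real_sign_eq_coe_sign,
    Real.rpow_sub_one (abs_ne_zero.2 hU), ← real_sign_mul_inv_abs (uFun Ψ F x)]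
  rw [uPow]
  ring

lemma normalFactor_eventuallyEq (hU : ∀ᶠ y in 𝓝 x, uFun Ψ F y ≠ 0) :
    normalFactor Ψ F =ᶠ[𝓝 x] fun y => uPow Ψ F y * hessDet Ψ F y * (uFun Ψ F y)⁻¹ :=
  hU.mono fun _ => normalFactor_eq

lemma contDiffAt_normalFactor {k : ℕ∞} (hF : ContDiffAt ℝ (k + 2) F x) (hU : uFun Ψ F x ≠ 0) :
    ContDiffAt ℝ k (normalFactor Ψ F) x :=
  (((contDiffAt_uPow hF hU).mul (contDiffAt_hessDet hF)).mul
    ((contDiffAt_uFun hF).inv hU)).congr_of_eventuallyEq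
      (normalFactor_eventuallyEq ((contDiffAt_uFun hF).continuousAt.eventually_ne hU))

lemma fderiv_normalFactor (hF : ContDiffAt ℝ 3 F x) (hH : hessDet Ψ F x ≠ 0)
    (hU : uFun Ψ F x ≠ 0) :
    fderiv ℝ (normalFactor Ψ F) x = normalFactor Ψ F x •
      ((hessDet Ψ F x)⁻¹ • fderiv ℝ (hessDet Ψ F) x - ((n : ℝ) + 1) • muForm Ψ F x) := by
  have hF12 : ContDiffAt ℝ (1 + 2) F x := by norm_num [hF]
  have hdU := (contDiffAt_uFun (Ψ := Ψ) hF12).differentiableAt one_ne_zero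
  have hdH := (contDiffAt_hessDet (Ψ := Ψ) hF12).differentiableAt one_ne_zero
  have hdP := (contDiffAt_uPow (Ψ := Ψ) (k := 1) hF12 hU).differentiableAt one_ne_zero
  have hderiv := (hdP.hasFDerivAt.mul hdH.hasFDerivAt).mul
    ((hasDerivAt_inv hU).comp_hasFDerivAt x hdU.hasFDerivAt)
  rw [(normalFactor_eventuallyEq (hdU.continuousAt.eventually_ne hU)).fderiv_eq]
  refine hderiv.fderiv.trans ?_
  rw [fderiv_uPow hF hU, fderiv_uFun hU, normalFactor_eq hU]
  ext v
  simp only [smul_apply, add_apply, sub_apply, smul_eq_mul, Pi.mul_apply, Function.comp_apply]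
  field_simp
  ring

lemma contDiffAt_muForm {k : ℕ∞ω} (hF : ContDiffAt ℝ (k + 1 + 2) F x) (hU : uFun Ψ F x ≠ 0) :
    ContDiffAt ℝ k (muForm Ψ F) x :=
  (contDiffAt_const.mul (((contDiffAt_uFun hF).of_le le_self_add).inv hU)).smul
    ((contDiffAt_uFun hF).fderiv_right le_rfl)

lemma contDiffAt_aFun {k : ℕ∞ω} (hF : ContDiffAt ℝ (k + 1 + 2) F x) (hH : hessDet Ψ F x ≠ 0)
    (hU : uFun Ψ F x ≠ 0) : ContDiffAt ℝ k (aFun Ψ F) x :=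
  contDiffAt_const.sub ((contDiffAt_muForm hF hU).clm_apply
    ((contDiffAt_hessGrad hF (det_hess_ne_zero hH)).of_le le_self_add))

lemma muForm_apply_hessGrad : muForm Ψ F x (hessGrad F x) = 1 - aFun Ψ F x := by
  rw [aFun, sub_sub_cancel]

end PowerOfU

section AlternatingForms

variable {𝕜 V : Type*} [Field 𝕜] [AddCommGroup V] [Module 𝕜 V] [FiniteDimensional 𝕜 V] {m : ℕ}

lemma dual_mul_apply_cons (Ψ : V [⋀^Fin (m + 1)]→ₗ[𝕜] 𝕜) (hV : Module.finrank 𝕜 V = m + 1)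
    {α : Module.Dual 𝕜 V} {X : Fin m → V} (hX : ∀ i, α (X i) = 0) (u v : V) :
    α u * Ψ (Fin.cons v X) = α v * Ψ (Fin.cons u X) := by
  obtain rfl | hα := eq_or_ne α 0
  · simp
  have hker : Module.finrank 𝕜 (LinearMap.ker α) < m + 1 := by
    have := Module.Dual.finrank_ker_add_one_of_ne_zero hα
    omega
  have hw : Ψ.curryLeft (α u • v - α v • u) X = 0 := by
    refine Ψ.map_linearDependent (Fin.cons (α u • v - α v • u) X) fun hli => ?_
    refine hker.not_ge ?_
    have hmem (i) : (Fin.cons (α u • v - α v • u) X : Fin (m + 1) → V) i ∈ LinearMap.ker α :=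
      Fin.cases (by simp [mul_comm]) hX i
    have hli' : LinearIndependent 𝕜 fun i => (⟨_, hmem i⟩ : LinearMap.ker α) :=
      LinearIndependent.of_comp (LinearMap.ker α).subtype hli
    simpa using hli'.fintype_card_le_finrank
  rw [map_sub, map_smul, map_smul] at hw
  exact sub_eq_zero.1 hw

lemma exists_apply_cons_ne_zero {Ψ : V [⋀^Fin (m + 1)]→ₗ[𝕜] 𝕜} (hΨ : Ψ ≠ 0)
    (hV : Module.finrank 𝕜 V = m + 1) {α : Module.Dual 𝕜 V} {v : V} (hv : α v ≠ 0) :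
    ∃ X : Fin m → LinearMap.ker α, Ψ (Fin.cons v fun i => (X i : V)) ≠ 0 := by
  have hα : α ≠ 0 := fun h => hv (by simp [h])
  have hker : Module.finrank 𝕜 (LinearMap.ker α) = m := by
    have := Module.Dual.finrank_ker_add_one_of_ne_zero hα
    omega
  let b := Module.finBasisOfFinrankEq 𝕜 (LinearMap.ker α) hker
  have hli : LinearIndependent 𝕜 (Fin.cons v fun i => (b i : V) : Fin (m + 1) → V) := by
    refine linearIndependent_finCons.2
      ⟨b.linearIndependent.map' (LinearMap.ker α).subtype (Submodule.ker_subtype _), fun hs => ?_⟩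
    exact hv (Submodule.span_le.2 (range_subset_iff.2 fun i => (b i).2) hs)
  refine ⟨b, ?_⟩
  rw [← coe_basisOfLinearIndependentOfCardEqFinrank hli (by simp [hV])]
  exact (Ψ.map_basis_ne_zero_iff _).2 hΨ

end AlternatingForms

section Gram

variable {n m : ℕ} {Ψ : VolForm n} {F : Space n → ℝ} {x : Space n}

/-- The Gram matrix of a family of vectors with respect to the Hessian. -/
noncomputable def gram (F : Space n → ℝ) (x : Space n) (X : Fin m → Space n) :
    Matrix (Fin m) (Fin m) ℝ :=
  Matrix.of fun i j => hessForm F x (X i) (X j)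

lemma volForm_ne_zero (hH : hessDet Ψ F x ≠ 0) : Ψ basisVec ≠ 0 :=
  fun h => hH (by simp [hessDet, h])

lemma volForm_eq_mul_det (M : Fin (n + 1) → Space n) :
    Ψ M = Ψ basisVec * (Matrix.of M).det := by
  have hb : ⇑(Pi.basisFun ℝ (Fin (n + 1))) = basisVec := funext (Pi.basisFun_apply ℝ _)
  conv_lhs => rw [Ψ.eq_smul_basis_det (Pi.basisFun ℝ (Fin (n + 1))), hb]
  rw [AlternatingMap.smul_apply, Pi.basisFun_det, smul_eq_mul]
  rfl

lemma det_gram (hF : ContDiffAt ℝ 2 F x) (hΨ : Ψ basisVec ≠ 0) (X : Fin (n + 1) → Space n) :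
    (gram F x X).det = hessDet Ψ F x * Ψ X ^ 2 := by
  have hgram : gram F x X = Matrix.of X * hess F x * (Matrix.of X).transpose := by
    ext i j
    rw [Matrix.mul_assoc, Matrix.mul_apply]
    exact hessForm_apply hF (X i) (X j)
  rw [hgram, Matrix.det_mul, Matrix.det_mul, Matrix.det_transpose, volForm_eq_mul_det, hessDet]
  field_simp

lemma det_gram_cons_hessGrad (hF : ContDiffAt ℝ 2 F x) (hx : (hess F x).det ≠ 0)
    {X : Fin m → Space n} (hX : ∀ i, X i ∈ tangent F x) :
    (gram F x (Fin.cons (hessGrad F x) X)).det =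
      fderiv ℝ F x (hessGrad F x) * (gram F x X).det := by
  have horth (j : Fin m) : gram F x (Fin.cons (hessGrad F x) X) 0 j.succ = 0 := by
    simpa [gram, hessForm_hessGrad hF hx] using hX j
  rw [Matrix.det_succ_row_zero, Fin.sum_univ_succ]
  simp only [horth, mul_zero, zero_mul, Finset.sum_const_zero, add_zero, Fin.val_zero, pow_zero,
    one_mul]
  congr 1
  simp [gram, hessForm_hessGrad hF hx]

lemma uFun_mul_volForm_cons_sq (hF : ContDiffAt ℝ 2 F x) (hH : hessDet Ψ F x ≠ 0)
    (hU : uFun Ψ F x ≠ 0) (v : Space n) {X : Fin n → Space n} (hX : ∀ i, X i ∈ tangent F x) :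
    uFun Ψ F x * Ψ (Fin.cons v X) ^ 2 = fderiv ℝ F x v ^ 2 * (gram F x X).det := by
  have hgram : hessDet Ψ F x * Ψ (Fin.cons (hessGrad F x) X) ^ 2 =
      uFun Ψ F x * (hessDet Ψ F x)⁻¹ * (gram F x X).det := by
    rw [← det_gram hF (volForm_ne_zero hH), det_gram_cons_hessGrad hF (det_hess_ne_zero hH) hX,
      fderiv_apply_hessGrad hH]
  have hcons : uFun Ψ F x * (hessDet Ψ F x)⁻¹ * Ψ (Fin.cons v X) =
      fderiv ℝ F x v * Ψ (Fin.cons (hessGrad F x) X) := by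
    rw [← fderiv_apply_hessGrad hH]
    exact dual_mul_apply_cons Ψ (by simp) (α := (fderiv ℝ F x).toLinearMap) hX _ _
  field_simp at hgram hcons
  refine mul_left_cancel₀ hU ?_
  calc uFun Ψ F x * (uFun Ψ F x * Ψ (Fin.cons v X) ^ 2)
      = (uFun Ψ F x * Ψ (Fin.cons v X)) ^ 2 := by ring
    _ = fderiv ℝ F x v ^ 2 *
          (hessDet Ψ F x ^ 2 * Ψ (Fin.cons (hessGrad F x) X) ^ 2) := by rw [hcons]; ring
    _ = uFun Ψ F x * (fderiv ℝ F x v ^ 2 * (gram F x X).det) := by rw [hgram]; ring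

end Gram

section Induced

variable {n : ℕ} {Ψ : VolForm n} {F : Space n → ℝ} {N : Space n → Space n} {x : Space n}

lemma exists_contDiffAt_tangent_field {k : ℕ∞ω} (hF : ContDiffAt ℝ (k + 1) F x)
    (hx : fderiv ℝ F x ≠ 0) (v : tangent F x) :
    ∃ Y : Space n → Space n, ContDiffAt ℝ k Y x ∧ (∀ᶠ y in 𝓝 x, Y y ∈ tangent F y) ∧ Y x = v := by
  obtain ⟨w, hw⟩ := exists_apply_eq_one hx
  have hd : ContDiffAt ℝ k (fderiv ℝ F) x := hF.fderiv_right le_rfl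
  have hdw : ContDiffAt ℝ k (fun y => fderiv ℝ F y w) x := hd.clm_apply contDiffAt_const
  have hw0 : fderiv ℝ F x w ≠ 0 := by simp [hw]
  refine ⟨fun y => (v : Space n) - (fderiv ℝ F y v * (fderiv ℝ F y w)⁻¹) • w, ?_, ?_, ?_⟩
  · exact contDiffAt_const.sub
      (((hd.clm_apply contDiffAt_const).mul (hdw.inv hw0)).smul contDiffAt_const)
  · filter_upwards [hdw.continuousAt.eventually_ne hw0] with y hy
    simp [hy]
  · have hv : fderiv ℝ F x (v : Space n) = 0 := v.2
    simp [hv]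

lemma fderiv_fderiv_apply_of_tangent (hF : ContDiffAt ℝ 2 F x) {Y : Space n → Space n}
    (hY : DifferentiableAt ℝ Y x) (hYt : ∀ᶠ y in 𝓝 x, Y y ∈ tangent F y) (v : Space n) :
    fderiv ℝ F x (fderiv ℝ Y x v) = -hessForm F x v (Y x) := by
  have hzero : (fun y => fderiv ℝ F y (Y y)) =ᶠ[𝓝 x] fun _ => (0 : ℝ) := hYt
  have hderiv := fderiv_fderiv_apply hF hY v
  rw [hzero.fderiv_eq, fderiv_fun_const, Pi.zero_apply, zero_apply] at hderiv
  exact (neg_eq_of_add_eq_zero_right hderiv.symm).symm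

section

variable {h : LinearMap.BilinForm ℝ (tangent F x)} {S : tangent F x →ₗ[ℝ] tangent F x}
  {τ : tangent F x →ₗ[ℝ] ℝ}

lemma IsInduced.secondFundamentalForm_eq (hI : IsInduced F N x h S τ) (hF : ContDiffAt ℝ ∞ F x)
    (hx : fderiv ℝ F x ≠ 0) (X Y : tangent F x) :
    h X Y = -(fderiv ℝ F x (N x))⁻¹ * hessForm F x X Y := by
  have hN : fderiv ℝ F x (N x) ≠ 0 := hI.transverse
  obtain ⟨Y', hY', hYt, hYx⟩ := exists_contDiffAt_tangent_field (k := ∞) hF hx Y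
  have hgauss : fderiv ℝ F x (fderiv ℝ Y' x X - h X Y • N x) = 0 :=
    hI.gauss Y' hY' hYt X Y hYx.symm
  rw [map_sub, map_smul, fderiv_fderiv_apply_of_tangent (hF.of_le ENat.LEInfty.out)
    (hY'.differentiableAt (by simp)) hYt, hYx, smul_eq_mul] at hgauss
  field_simp
  linarith

lemma IsInduced.shapeOperator_apply (hI : IsInduced F N x h S 0) (X : tangent F x) :
    (S X : Space n) = -fderiv ℝ N x X := by
  simp [hI.weingarten X]

lemma IsInduced.connectionForm_eq_zero (hI : IsInduced F N x h S τ)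
    (hN : ∀ X ∈ tangent F x, fderiv ℝ N x X ∈ tangent F x) : τ = 0 := by
  ext X
  have hSX : fderiv ℝ F x (S X) = 0 := (S X).2
  have hNX : fderiv ℝ F x (fderiv ℝ N x X) = 0 := hN X X.2
  rw [hI.weingarten, map_add, map_neg, hSX, neg_zero, zero_add, map_smul, smul_eq_mul] at hNX
  exact (mul_eq_zero.1 hNX).resolve_right hI.transverse

lemma IsInduced.pow_mul_abs_det (hI : IsInduced F N x h S τ) (hF : ContDiffAt ℝ ∞ F x)
    (hH : hessDet Ψ F x ≠ 0) (hU : uFun Ψ F x ≠ 0) (X : Fin n → tangent F x) :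
    |fderiv ℝ F x (N x)| ^ (n + 2) * |(Matrix.of fun i j => h (X i) (X j)).det| =
      |uFun Ψ F x| * Ψ (Fin.cons (N x) fun i => (X i : Space n)) ^ 2 := by
  have hN : fderiv ℝ F x (N x) ≠ 0 := hI.transverse
  have hh : (Matrix.of fun i j => h (X i) (X j)) =
      (-(fderiv ℝ F x (N x))⁻¹) • gram F x fun i => (X i : Space n) := by
    ext i j
    exact hI.secondFundamentalForm_eq hF (fderiv_ne_zero hH hU) (X i) (X j)
  have hvol := congrArg abs (uFun_mul_volForm_cons_sq (hF.of_le ENat.LEInfty.out) hH hU (N x)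
    fun i => (X i).2)
  rw [abs_mul, abs_mul, abs_sq, abs_pow] at hvol
  rw [hvol, hh, Matrix.det_smul, abs_mul, abs_pow, abs_neg, abs_inv, Fintype.card_fin, pow_add,
    inv_pow]
  have := abs_ne_zero.2 hN
  field_simp

lemma exists_isInduced (hF : ContDiffAt ℝ 2 F x) (hN : N x ∉ tangent F x)
    (hNt : ∀ X ∈ tangent F x, fderiv ℝ N x X ∈ tangent F x) :
    ∃ (h : LinearMap.BilinForm ℝ (tangent F x)) (S : tangent F x →ₗ[ℝ] tangent F x),
      IsInduced F N x h S 0 := by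
  refine ⟨(-(fderiv ℝ F x (N x))⁻¹) • (hessForm F x).toLinearMap₁₂.domRestrict₁₂ _ _,
    -(fderiv ℝ N x).toLinearMap.restrict hNt, hN, fun Y hY hYt X Yx hYx => ?_, fun X => by simp⟩
  have hN' : fderiv ℝ F x (N x) ≠ 0 := hN
  change fderiv ℝ F x (_ - (-(fderiv ℝ F x (N x))⁻¹ * hessForm F x X Yx) • N x) = 0
  rw [map_sub, map_smul, fderiv_fderiv_apply_of_tangent hF (hY.differentiableAt (by simp)) hYt,
    hYx, smul_eq_mul]
  field_simp
  ring

end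

end Induced

section EquiaffineNormal

variable {n : ℕ} {Ψ : VolForm n} {F : Space n → ℝ} {W : Set (Space n)} {N : Space n → Space n}
  {x : Space n}

/-- `F` is smooth on the open set `W` and neither `H(F)` nor `U(F)` vanishes there, so that the
level sets of `F` in `W` are nondegenerate hypersurfaces. -/
structure IsNondegenerateOn (Ψ : VolForm n) (F : Space n → ℝ) (W : Set (Space n)) : Prop where
  isOpen : IsOpen W
  contDiffOn : ContDiffOn ℝ ∞ F W
  hessDet_ne_zero : ∀ x ∈ W, hessDet Ψ F x ≠ 0
  uFun_ne_zero : ∀ x ∈ W, uFun Ψ F x ≠ 0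

lemma IsNondegenerateOn.contDiffAt (hD : IsNondegenerateOn Ψ F W) (hx : x ∈ W) (k : ℕ∞ω)
    [ENat.LEInfty k] : ContDiffAt ℝ k F x :=
  (hD.contDiffOn.contDiffAt (hD.isOpen.mem_nhds hx)).of_le ENat.LEInfty.out

lemma IsNondegenerateOn.fderiv_ne_zero (hD : IsNondegenerateOn Ψ F W) (hx : x ∈ W) :
    fderiv ℝ F x ≠ 0 :=
  LevelSetAffine.fderiv_ne_zero (hD.hessDet_ne_zero x hx) (hD.uFun_ne_zero x hx)

/-- The explicit formula `-(|U|^{1/(n+2)} μ^i + sign(U) H |U|^{-(n+1)/(n+2)} A F^i)` for the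
equiaffine normal of the level sets of `F`, the index of `μ` being raised with the Hessian. -/
noncomputable def affineNormal (Ψ : VolForm n) (F : Space n → ℝ) (x : Space n) : Space n :=
  -(uPow Ψ F x • sharp F x (muForm Ψ F x) + (normalFactor Ψ F x * aFun Ψ F x) • hessGrad F x)

lemma fderiv_apply_affineNormal (hF : ContDiffAt ℝ 2 F x) (hH : hessDet Ψ F x ≠ 0)
    (hU : uFun Ψ F x ≠ 0) : fderiv ℝ F x (affineNormal Ψ F x) = -uPow Ψ F x := by
  rw [affineNormal, map_neg, map_add, map_smul, map_smul,
    fderiv_apply_sharp hF (det_hess_ne_zero hH), muForm_apply_hessGrad, fderiv_apply_hessGrad hH,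
    normalFactor_eq hU, smul_eq_mul, smul_eq_mul]
  field_simp
  ring

lemma hessForm_affineNormal (hF : ContDiffAt ℝ 2 F x) (hx : (hess F x).det ≠ 0) :
    hessForm F x (affineNormal Ψ F x) =
      -(uPow Ψ F x • muForm Ψ F x + (normalFactor Ψ F x * aFun Ψ F x) • fderiv ℝ F x) := by
  rw [affineNormal, map_neg, map_add, map_smul, map_smul, hessForm_sharp hF hx,
    hessForm_hessGrad hF hx]

lemma contDiffOn_affineNormal (hD : IsNondegenerateOn Ψ F W) :
    ContDiffOn ℝ ∞ (affineNormal Ψ F) W := fun x hx => by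
  have hF := hD.contDiffAt hx ∞
  have hH := hD.hessDet_ne_zero x hx
  have hU := hD.uFun_ne_zero x hx
  refine (ContDiffAt.neg ?_).contDiffWithinAt
  exact ((contDiffAt_uPow (k := ⊤) hF hU).smul
    (contDiffAt_sharp (k := ∞) hF (det_hess_ne_zero hH) (contDiffAt_muForm (k := ∞) hF hU))).add
    (((contDiffAt_normalFactor (k := ⊤) hF hU).mul (contDiffAt_aFun (k := ∞) hF hH hU)).smul
      (contDiffAt_hessGrad (k := ∞) hF (det_hess_ne_zero hH)))

lemma hessForm_apply_add (hF : ContDiffAt ℝ 3 F x) (hU : uFun Ψ F x ≠ 0)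
    (hNd : DifferentiableAt ℝ N x) (hN : ∀ᶠ y in 𝓝 x, fderiv ℝ F y (N y) = -uPow Ψ F y)
    (v : Space n) :
    hessForm F x v (N x) + fderiv ℝ F x (fderiv ℝ N x v) = -(uPow Ψ F x * muForm Ψ F x v) := by
  have hN' : (fun y => fderiv ℝ F y (N y)) =ᶠ[𝓝 x] fun y => -uPow Ψ F y := hN
  rw [← fderiv_fderiv_apply (hF.of_le (by norm_num)) hNd, hN'.fderiv_eq, fderiv_fun_neg,
    fderiv_uPow hF hU]
  simp

lemma fderiv_apply_neg_sign_smul_hessGrad_neg (hH : hessDet Ψ F x ≠ 0) (hU : uFun Ψ F x ≠ 0) :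
    fderiv ℝ F x (-(Real.sign (uFun Ψ F x * hessDet Ψ F x)) • hessGrad F x) < 0 := by
  have hsign := Real.sign_mul_pos_of_ne_zero _ (mul_ne_zero hU hH)
  have hval : fderiv ℝ F x (-(Real.sign (uFun Ψ F x * hessDet Ψ F x)) • hessGrad F x) =
      -(Real.sign (uFun Ψ F x * hessDet Ψ F x) * (uFun Ψ F x * hessDet Ψ F x) *
        (hessDet Ψ F x)⁻¹ ^ 2) := by
    rw [map_smul, fderiv_apply_hessGrad hH, smul_eq_mul]
    field_simp
  rw [hval, neg_lt_zero]
  positivity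

lemma IsEquiaffineNormal.fderiv_mem_tangent (hN : IsEquiaffineNormal Ψ F W N) (hx : x ∈ W)
    {X : Space n} (hX : X ∈ tangent F x) : fderiv ℝ N x X ∈ tangent F x := by
  obtain ⟨h, S, τ, hI, rfl, -⟩ := hN.normalized x hx
  rw [hI.weingarten ⟨X, hX⟩]
  simp

lemma IsEquiaffineNormal.fderiv_apply (hN : IsEquiaffineNormal Ψ F W N)
    (hD : IsNondegenerateOn Ψ F W) (hx : x ∈ W) : fderiv ℝ F x (N x) = -uPow Ψ F x := by
  have hH := hD.hessDet_ne_zero x hx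
  have hU := hD.uFun_ne_zero x hx
  obtain ⟨h, S, τ, hI, -, hdet⟩ := hN.normalized x hx
  have hΨ : Ψ ≠ 0 := fun h0 => volForm_ne_zero hH (by simp [h0])
  obtain ⟨X, hX⟩ := exists_apply_cons_ne_zero hΨ (by simp)
    (α := (fderiv ℝ F x).toLinearMap) hI.transverse
  have habs : |fderiv ℝ F x (N x)| = uPow Ψ F x := by
    refine (pow_left_inj₀ (abs_nonneg _) (uPow_pos hU).le (Nat.succ_ne_zero (n + 1))).1 ?_
    have hvol := hI.pow_mul_abs_det (hD.contDiffAt hx ∞) hH hU X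
    rw [hdet X] at hvol
    rw [uPow_pow]
    exact mul_right_cancel₀ (pow_ne_zero 2 hX) hvol
  have hneg : fderiv ℝ F x (N x) < 0 := by
    by_contra! hnonneg
    exact (hN.cooriented x hx).not_ge (mul_nonpos_of_nonneg_of_nonpos hnonneg
      (fderiv_apply_neg_sign_smul_hessGrad_neg hH hU).le)
  rw [← habs, abs_of_neg hneg, neg_neg]

lemma isEquiaffineNormal_of_fderiv (hD : IsNondegenerateOn Ψ F W) (hN : ContDiffOn ℝ ∞ N W)
    (hval : ∀ x ∈ W, fderiv ℝ F x (N x) = -uPow Ψ F x)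
    (htan : ∀ x ∈ W, ∀ X ∈ tangent F x, fderiv ℝ N x X ∈ tangent F x) :
    IsEquiaffineNormal Ψ F W N := by
  refine ⟨hN, fun x hx => ?_, fun x hx => ?_⟩
  all_goals
    have hH := hD.hessDet_ne_zero x hx
    have hU := hD.uFun_ne_zero x hx
    have hpos := uPow_pos hU
  · have htransverse : N x ∉ tangent F x := fun h0 =>
      neg_ne_zero.2 hpos.ne' ((hval x hx).symm.trans h0)
    obtain ⟨h, S, hI⟩ := exists_isInduced (hD.contDiffAt hx 2) htransverse (htan x hx)
    refine ⟨h, S, 0, hI, rfl, fun X => mul_left_cancel₀ (abs_ne_zero.2 hU) ?_⟩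
    rw [← hI.pow_mul_abs_det (hD.contDiffAt hx ∞) hH hU, hval x hx, abs_neg, abs_of_pos hpos,
      uPow_pow]
  · rw [hval x hx]
    exact mul_pos_of_neg_of_neg (neg_neg_of_pos hpos)
      (fderiv_apply_neg_sign_smul_hessGrad_neg hH hU)

lemma isEquiaffineNormal_affineNormal (hD : IsNondegenerateOn Ψ F W) :
    IsEquiaffineNormal Ψ F W (affineNormal Ψ F) := by
  have hN := contDiffOn_affineNormal hD
  have hval (x) (hx : x ∈ W) : fderiv ℝ F x (affineNormal Ψ F x) = -uPow Ψ F x :=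
    fderiv_apply_affineNormal (hD.contDiffAt hx 2) (hD.hessDet_ne_zero x hx)
      (hD.uFun_ne_zero x hx)
  refine isEquiaffineNormal_of_fderiv hD hN hval fun x hx X (hX : fderiv ℝ F x X = 0) => ?_
  have hW := hD.isOpen.mem_nhds hx
  have hderiv := hessForm_apply_add (hD.contDiffAt hx 3) (hD.uFun_ne_zero x hx)
    ((hN.contDiffAt hW).differentiableAt (by simp)) (eventually_of_mem hW hval) X
  rw [hessForm_comm (hD.contDiffAt hx 2), hessForm_affineNormal (hD.contDiffAt hx 2)
    (det_hess_ne_zero (hD.hessDet_ne_zero x hx))] at hderiv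
  simpa [hX] using hderiv

lemma eq_of_hessForm_eqOn_tangent (hF : ContDiffAt ℝ 2 F x) (hx : (hess F x).det ≠ 0)
    (hG : hessGrad F x ∉ tangent F x) {u v : Space n} (hval : fderiv ℝ F x u = fderiv ℝ F x v)
    (htan : ∀ X ∈ tangent F x, hessForm F x u X = hessForm F x v X) : u = v := by
  rw [← sharp_hessForm hF hx u, ← sharp_hessForm hF hx v]
  congr 1
  ext w
  have hG' : fderiv ℝ F x (hessGrad F x) ≠ 0 := hG
  set c := fderiv ℝ F x w / fderiv ℝ F x (hessGrad F x) with hc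
  have hmem : w - c • hessGrad F x ∈ tangent F x := by simp [hc, hG']
  have hgrad (z : Space n) : hessForm F x z (hessGrad F x) = fderiv ℝ F x z := by
    rw [hessForm_comm hF, hessForm_hessGrad hF hx]
  simpa [hgrad, hval] using htan _ hmem

lemma IsEquiaffineNormal.hessForm_apply_add (hN : IsEquiaffineNormal Ψ F W N)
    (hD : IsNondegenerateOn Ψ F W) (hx : x ∈ W) (v : Space n) :
    hessForm F x (N x) v + fderiv ℝ F x (fderiv ℝ N x v) = -(uPow Ψ F x * muForm Ψ F x v) := by
  have hW := hD.isOpen.mem_nhds hx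
  rw [hessForm_comm (hD.contDiffAt hx 2)]
  exact LevelSetAffine.hessForm_apply_add (hD.contDiffAt hx 3) (hD.uFun_ne_zero x hx)
    ((hN.smooth.contDiffAt hW).differentiableAt (by simp))
    (eventually_of_mem hW fun y hy => hN.fderiv_apply hD hy) v

lemma IsEquiaffineNormal.eq_affineNormal (hN : IsEquiaffineNormal Ψ F W N)
    (hD : IsNondegenerateOn Ψ F W) (hx : x ∈ W) : N x = affineNormal Ψ F x := by
  have hF := hD.contDiffAt hx 2
  have hH := hD.hessDet_ne_zero x hx
  have hU := hD.uFun_ne_zero x hx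
  have hG : hessGrad F x ∉ tangent F x := fun hG =>
    mul_ne_zero hU (inv_ne_zero hH) ((fderiv_apply_hessGrad hH).symm.trans hG)
  refine eq_of_hessForm_eqOn_tangent hF (det_hess_ne_zero hH) hG ?_ fun X hX => ?_
  · rw [hN.fderiv_apply hD hx, fderiv_apply_affineNormal hF hH hU]
  · have hX' : fderiv ℝ F x X = 0 := hX
    have hNX : fderiv ℝ F x (fderiv ℝ N x X) = 0 := hN.fderiv_mem_tangent hx hX
    have hderiv := hN.hessForm_apply_add hD hx X
    rw [hNX, add_zero] at hderiv
    rw [hderiv, hessForm_affineNormal hF (det_hess_ne_zero hH)]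
    simp [hX']

lemma IsEquiaffineNormal.fderiv_fderiv_apply (hN : IsEquiaffineNormal Ψ F W N)
    (hD : IsNondegenerateOn Ψ F W) (hx : x ∈ W) (v : Space n) :
    fderiv ℝ F x (fderiv ℝ N x v) = normalFactor Ψ F x * aFun Ψ F x * fderiv ℝ F x v := by
  have hderiv := hN.hessForm_apply_add hD hx v
  rw [hN.eq_affineNormal hD hx, hessForm_affineNormal (hD.contDiffAt hx 2)
    (det_hess_ne_zero (hD.hessDet_ne_zero x hx))] at hderiv
  simp only [neg_apply, add_apply, smul_apply, smul_eq_mul] at hderiv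
  linarith

end EquiaffineNormal

section Equivalences

lemma forall_mul_sub_mul_eq_zero_iff {𝕜 E : Type*} [Field 𝕜] [TopologicalSpace 𝕜]
    [IsTopologicalRing 𝕜] [AddCommGroup E] [Module 𝕜 E] [TopologicalSpace E] {α β : E →L[𝕜] 𝕜}
    (hβ : β ≠ 0) : (∀ u v, α u * β v - α v * β u = 0) ↔ ∃ c : 𝕜, α = c • β := by
  constructor
  · intro h
    obtain ⟨w, hw⟩ := exists_apply_eq_one hβ
    refine ⟨α w, ContinuousLinearMap.ext fun u => ?_⟩
    simpa [hw, sub_eq_zero] using h u w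
  · rintro ⟨c, rfl⟩ u v
    simp only [smul_apply, smul_eq_mul]
    ring

lemma exists_smul_eq_smul_iff {𝕜 E : Type*} [DivisionRing 𝕜] [AddCommGroup E] [Module 𝕜 E]
    {a : 𝕜} (ha : a ≠ 0) {u v : E} : (∃ c : 𝕜, a • u = c • v) ↔ ∃ c : 𝕜, u = c • v := by
  constructor
  · rintro ⟨c, hc⟩
    exact ⟨a⁻¹ * c, by rw [mul_smul, ← hc, inv_smul_smul₀ ha]⟩
  · rintro ⟨c, rfl⟩
    exact ⟨a * c, (mul_smul a c v).symm⟩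

variable {n : ℕ} {Ψ : VolForm n} {F : Space n → ℝ} {W : Set (Space n)} {N : Space n → Space n}
  {x : Space n}

lemma wedge_conormal_eq_zero_iff (hH : hessDet Ψ F x ≠ 0) (hU : uFun Ψ F x ≠ 0) :
    (∀ u v, wedge (muForm Ψ F) (conormal Ψ F) x u v = 0) ↔
      ∃ c : ℝ, muForm Ψ F x = c • fderiv ℝ F x := by
  have hP : -(uPow Ψ F x)⁻¹ ≠ 0 := neg_ne_zero.2 (inv_ne_zero (uPow_pos hU).ne')
  rw [← forall_mul_sub_mul_eq_zero_iff (fderiv_ne_zero hH hU)]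
  refine forall₂_congr fun u v => ?_
  have hwedge : wedge (muForm Ψ F) (conormal Ψ F) x u v = -(uPow Ψ F x)⁻¹ *
      (muForm Ψ F x u * fderiv ℝ F x v - muForm Ψ F x v * fderiv ℝ F x u) := by
    rw [wedge, conormal_eq, smul_apply, smul_apply, smul_eq_mul, smul_eq_mul]
    ring
  rw [hwedge, mul_eq_zero_iff_left hP]

lemma muForm_eq_iff (hH : hessDet Ψ F x ≠ 0) (hU : uFun Ψ F x ≠ 0) :
    muForm Ψ F x = ((uFun Ψ F x)⁻¹ * hessDet Ψ F x * (1 - aFun Ψ F x)) • fderiv ℝ F x ↔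
      ∃ c : ℝ, muForm Ψ F x = c • fderiv ℝ F x := by
  refine ⟨fun h => ⟨_, h⟩, fun ⟨c, hc⟩ => ?_⟩
  have hA : 1 - aFun Ψ F x = c * (uFun Ψ F x * (hessDet Ψ F x)⁻¹) := by
    rw [← muForm_apply_hessGrad, hc, smul_apply, fderiv_apply_hessGrad hH, smul_eq_mul]
  rw [hA, hc]
  field_simp

lemma differentiableAt_conormal (hF : ContDiffAt ℝ 3 F x) (hU : uFun Ψ F x ≠ 0) :
    DifferentiableAt ℝ (conormal Ψ F) x := by
  have hP : DifferentiableAt ℝ (uPow Ψ F) x :=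
    (contDiffAt_uPow (k := 1) (by norm_num [hF]) hU).differentiableAt one_ne_zero
  rw [show conormal Ψ F = _ from funext fun _ => conormal_eq]
  exact (hP.inv (uPow_pos hU).ne').neg.smul (differentiableAt_fderiv (hF.of_le (by norm_num)))

lemma fderiv_conormal_apply (hF : ContDiffAt ℝ 3 F x) (hU : uFun Ψ F x ≠ 0) (u v : Space n) :
    fderiv ℝ (conormal Ψ F) x u v =
      (uPow Ψ F x)⁻¹ * (muForm Ψ F x u * fderiv ℝ F x v - hessForm F x u v) := by
  have hP : DifferentiableAt ℝ (uPow Ψ F) x :=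
    (contDiffAt_uPow (k := 1) (by norm_num [hF]) hU).differentiableAt one_ne_zero
  have hderiv := ((hasDerivAt_inv (uPow_pos hU).ne').comp_hasFDerivAt x hP.hasFDerivAt).neg.smul
    (differentiableAt_fderiv (hF.of_le (by norm_num))).hasFDerivAt
  have hne := (uPow_pos hU).ne'
  rw [show conormal Ψ F = _ from funext fun _ => conormal_eq]
  refine (congrArg (fun m : Space n →L[ℝ] Space n →L[ℝ] ℝ => m u v) hderiv.fderiv).trans ?_
  rw [fderiv_uPow hF hU]
  simp only [Pi.neg_apply, Function.comp_apply, neg_smul, neg_neg, add_apply, neg_apply,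
    smul_apply, ContinuousLinearMap.smulRight_apply, smul_eq_mul]
  field_simp
  ring

lemma extD_apply {α : Space n → Space n →L[ℝ] ℝ} (hα : DifferentiableAt ℝ α x)
    (v : Fin 2 → Space n) :
    extD α x v = fderiv ℝ α x (v 0) (v 1) - fderiv ℝ α x (v 1) (v 0) := by
  have h : HasFDerivAt (fun y => ContinuousAlternatingMap.ofSubsingleton ℝ (Space n) ℝ
      (0 : Fin 1) (α y)) _ x :=
    (ContinuousAlternatingMap.ofSubsingletonLIE (𝕜 := ℝ) (E := Space n) (F := ℝ)
      (0 : Fin 1)).toContinuousLinearEquiv.toContinuousLinearMap.hasFDerivAt.comp x hα.hasFDerivAt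
  rw [extD, extDeriv, h.fderiv, ContinuousAlternatingMap.alternatizeUncurryFin_apply,
    Fin.sum_univ_two]
  simp [sub_eq_add_neg, Fin.removeNth, Fin.tail]

lemma extD_conormal_apply (hF : ContDiffAt ℝ 3 F x) (hU : uFun Ψ F x ≠ 0)
    (v : Fin 2 → Space n) :
    extD (conormal Ψ F) x v = -wedge (muForm Ψ F) (conormal Ψ F) x (v 0) (v 1) := by
  rw [extD_apply (differentiableAt_conormal hF hU), fderiv_conormal_apply hF hU,
    fderiv_conormal_apply hF hU, hessForm_comm (hF.of_le (by norm_num)) (v 1), wedge, conormal_eq]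
  simp only [smul_apply, smul_eq_mul]
  ring

lemma extD_conormal_eq_zero_iff (hF : ContDiffAt ℝ 3 F x) (hU : uFun Ψ F x ≠ 0) :
    extD (conormal Ψ F) x = 0 ↔ ∀ u v, wedge (muForm Ψ F) (conormal Ψ F) x u v = 0 := by
  constructor
  · intro h u v
    have huv := extD_conormal_apply hF hU ![u, v]
    rw [h] at huv
    simpa using huv.symm
  · intro h
    ext v
    rw [extD_conormal_apply hF hU, h]
    simp

lemma lieD_conormal_apply (hD : IsNondegenerateOn Ψ F W) (hN : IsEquiaffineNormal Ψ F W N)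
    (hx : x ∈ W) (v : Space n) :
    lieD N (conormal Ψ F) x v =
      muForm Ψ F x v + (uPow Ψ F x)⁻¹ * muForm Ψ F x (N x) * fderiv ℝ F x v := by
  have hU := hD.uFun_ne_zero x hx
  have hne := (uPow_pos hU).ne'
  rw [lieD, add_apply, fderiv_conormal_apply (hD.contDiffAt hx 3) hU,
    ContinuousLinearMap.comp_apply, conormal_eq, smul_apply, smul_eq_mul,
    eq_sub_of_add_eq (hN.hessForm_apply_add hD hx v)]
  field_simp
  ring

lemma lieD_conormal_eq_zero_iff (hD : IsNondegenerateOn Ψ F W)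
    (hN : IsEquiaffineNormal Ψ F W N) (hx : x ∈ W) :
    lieD N (conormal Ψ F) x = 0 ↔ ∃ c : ℝ, muForm Ψ F x = c • fderiv ℝ F x := by
  constructor
  · intro h
    refine ⟨-((uPow Ψ F x)⁻¹ * muForm Ψ F x (N x)), ContinuousLinearMap.ext fun v => ?_⟩
    have hv := lieD_conormal_apply hD hN hx v
    rw [h, zero_apply] at hv
    simp only [smul_apply, smul_eq_mul]
    linarith
  · rintro ⟨c, hc⟩
    have hne := (uPow_pos (hD.uFun_ne_zero x hx)).ne'
    ext v
    rw [lieD_conormal_apply hD hN hx, hc]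
    simp only [smul_apply, smul_eq_mul, hN.fderiv_apply hD hx, zero_apply]
    field_simp
    ring

lemma eq_smul_hessGrad_iff (hD : IsNondegenerateOn Ψ F W) (hN : IsEquiaffineNormal Ψ F W N)
    (hx : x ∈ W) :
    (∃ c : ℝ, N x = c • hessGrad F x) ↔ ∃ c : ℝ, muForm Ψ F x = c • fderiv ℝ F x := by
  have hF := hD.contDiffAt hx 2
  have hdet := det_hess_ne_zero (hD.hessDet_ne_zero x hx)
  have hne := (uPow_pos (hD.uFun_ne_zero x hx)).ne'
  rw [hN.eq_affineNormal hD hx]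
  constructor
  · rintro ⟨c, hc⟩
    have hμ := hessForm_affineNormal (Ψ := Ψ) hF hdet
    rw [hc, map_smul, hessForm_hessGrad hF hdet, ← neg_eq_iff_eq_neg, ← sub_eq_iff_eq_add] at hμ
    refine (exists_smul_eq_smul_iff (u := muForm Ψ F x) hne).1
      ⟨-c - normalFactor Ψ F x * aFun Ψ F x, ?_⟩
    rw [← hμ, sub_smul, neg_smul]
  · rintro ⟨c, hc⟩
    refine ⟨-(uPow Ψ F x * c + normalFactor Ψ F x * aFun Ψ F x), ?_⟩
    rw [affineNormal, hc, map_smul, sharp_fderiv, smul_smul, ← add_smul, neg_smul]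

lemma eq_neg_normalFactor_smul_iff (hD : IsNondegenerateOn Ψ F W)
    (hN : IsEquiaffineNormal Ψ F W N) (hx : x ∈ W) :
    N x = (-normalFactor Ψ F x) • hessGrad F x ↔ ∃ c : ℝ, N x = c • hessGrad F x := by
  have hH := hD.hessDet_ne_zero x hx
  have hU := hD.uFun_ne_zero x hx
  refine ⟨fun h => ⟨_, h⟩, fun ⟨c, hc⟩ => ?_⟩
  have hval := hN.fderiv_apply hD hx
  rw [hc, map_smul, fderiv_apply_hessGrad hH, smul_eq_mul, ← eq_div_iff (by positivity)] at hval
  rw [hc, hval, normalFactor_eq hU]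
  congr 1
  field_simp

lemma forall_isLocallyConstant_levelSet_iff {U : Space n → ℝ} {I : Set ℝ} (hW : IsOpen W)
    (hI : MapsTo F W I) :
    (∀ r ∈ I, IsLocallyConstant fun x : levelSet F W r => U x) ↔
      ∀ x ∈ W, ∀ᶠ y in 𝓝 x, F y = F x → U y = U x := by
  constructor
  · intro h x hx
    have hloc := (h _ (hI hx)).eventually_eq ⟨x, hx, rfl⟩
    rw [nhds_subtype, eventually_comap] at hloc
    filter_upwards [hloc, hW.mem_nhds hx] with y hy hyW hFy
    exact hy ⟨y, hyW, hFy⟩ rfl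
  · intro h r _
    rw [IsLocallyConstant.iff_eventually_eq]
    rintro ⟨x, hx, hFx⟩
    filter_upwards [continuous_subtype_val.continuousAt.eventually (h x hx)] with y hy
    exact hy (y.2.2.trans hFx.symm)

lemma forall_isLocallyConstant_uFun_iff {I : Set ℝ} (hD : IsNondegenerateOn Ψ F W)
    (hI : MapsTo F W I) :
    (∀ r ∈ I, IsLocallyConstant fun x : levelSet F W r => uFun Ψ F x) ↔
      ∀ x ∈ W, ∃ c : ℝ, muForm Ψ F x = c • fderiv ℝ F x := by
  have hF : ContDiffOn ℝ 1 F W := hD.contDiffOn.of_le (by simp)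
  have hU : ContDiffOn ℝ 1 (uFun Ψ F) W := fun x hx =>
    (contDiffAt_uFun (by norm_num [hD.contDiffAt hx 3])).contDiffWithinAt
  rw [forall_isLocallyConstant_levelSet_iff hD.isOpen hI,
    forall_eventually_eq_iff_exists_fderiv_eq_smul hD.isOpen hF hU fun x => hD.fderiv_ne_zero]
  refine forall₂_congr fun x hx => ?_
  have hUx := hD.uFun_ne_zero x hx
  rw [fderiv_uFun hUx, exists_smul_eq_smul_iff (mul_ne_zero (by positivity) hUx)]

lemma IsEquiaffineNormal.flowPreservesLevelSets_iff (hN : IsEquiaffineNormal Ψ F W N)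
    (hD : IsNondegenerateOn Ψ F W) :
    FlowPreservesLevelSets F W N ↔ ∀ x ∈ W, ∃ c : ℝ, muForm Ψ F x = c • fderiv ℝ F x := by
  have hF : ContDiffOn ℝ 1 F W := hD.contDiffOn.of_le (by simp)
  have hval : EqOn (fun x => fderiv ℝ F x (N x)) (fun x => -uPow Ψ F x) W :=
    fun x => hN.fderiv_apply hD
  have hP : ContDiffOn ℝ 1 (fun x => -uPow Ψ F x) W := fun x hx =>
    (contDiffAt_uPow (k := 1) (by norm_num [hD.contDiffAt hx 3])
      (hD.uFun_ne_zero x hx)).neg.contDiffWithinAt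
  rw [LevelSetAffine.flowPreservesLevelSets_iff hD.isOpen (hN.smooth.of_le (by simp)) hF
    (fun x => hD.fderiv_ne_zero) (hP.congr hval)]
  refine forall₂_congr fun x hx => ?_
  have hUx := hD.uFun_ne_zero x hx
  rw [(hval.eventuallyEq_of_mem (hD.isOpen.mem_nhds hx)).fderiv_eq, fderiv_fun_neg,
    fderiv_uPow (hD.contDiffAt hx 3) hUx, ← neg_smul,
    exists_smul_eq_smul_iff (neg_ne_zero.2 (uPow_pos hUx).ne')]

end Equivalences

section Shape

variable {n : ℕ} {Ψ : VolForm n} {F : Space n → ℝ} {W : Set (Space n)} {N : Space n → Space n}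
  {x : Space n}

lemma inv_uPow_mul_normalFactor (hU : uFun Ψ F x ≠ 0) :
    (uPow Ψ F x)⁻¹ * normalFactor Ψ F x = (uFun Ψ F x)⁻¹ * hessDet Ψ F x := by
  have hne := (uPow_pos hU).ne'
  rw [normalFactor_eq hU]
  field_simp

lemma fderiv_apply_shapeTensor (hD : IsNondegenerateOn Ψ F W) (hN : IsEquiaffineNormal Ψ F W N)
    (hx : x ∈ W) (v : Space n) : fderiv ℝ F x (shapeTensor Ψ F N x v) = 0 := by
  have hne := (uPow_pos (hD.uFun_ne_zero x hx)).ne'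
  rw [shapeTensor, add_apply, neg_apply, smul_apply, ContinuousLinearMap.smulRight_apply, map_add,
    map_neg, map_smul, map_smul, hN.fderiv_fderiv_apply hD hx, hN.fderiv_apply hD hx, conormal_eq,
    smul_apply, smul_eq_mul, smul_eq_mul, smul_eq_mul]
  field_simp
  ring

lemma IsShapeOperator.apply_eq {S : tangent F x →ₗ[ℝ] tangent F x} (hS : IsShapeOperator F N x S)
    (hN : IsEquiaffineNormal Ψ F W N) (hx : x ∈ W) (X : tangent F x) :
    (S X : Space n) = shapeTensor Ψ F N x X := by
  obtain ⟨h, τ, hI⟩ := hS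
  obtain rfl := hI.connectionForm_eq_zero fun _ => hN.fderiv_mem_tangent hx
  have hX : fderiv ℝ F x X = 0 := X.2
  rw [hI.shapeOperator_apply, shapeTensor, add_apply, neg_apply, smul_apply,
    ContinuousLinearMap.smulRight_apply, conormal_eq, smul_apply, hX, smul_zero, zero_smul,
    smul_zero, add_zero]

lemma IsEquiaffineNormal.exists_isShapeOperator (hN : IsEquiaffineNormal Ψ F W N) (hx : x ∈ W) :
    ∃ S, IsShapeOperator F N x S :=
  let ⟨h, S, τ, hI, _⟩ := hN.normalized x hx
  ⟨S, h, τ, hI⟩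

lemma fderiv_apply_of_eventuallyEq (hF : ContDiffAt ℝ 3 F x) (hH : hessDet Ψ F x ≠ 0)
    (hU : uFun Ψ F x ≠ 0)
    (hN : N =ᶠ[𝓝 x] fun y => (-normalFactor Ψ F y) • hessGrad F y) (v : Space n) :
    fderiv ℝ N x v = (-normalFactor Ψ F x) • (v - sharp F x (thirdForm F x v (hessGrad F x)) +
      ((hessDet Ψ F x)⁻¹ * fderiv ℝ (hessDet Ψ F) x v - ((n : ℝ) + 1) * muForm Ψ F x v) •
        hessGrad F x) := by
  have hF12 : ContDiffAt ℝ (1 + 2) F x := by norm_num [hF]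
  have hdet := det_hess_ne_zero hH
  have hdnf := (contDiffAt_normalFactor (k := 1) hF12 hU).differentiableAt one_ne_zero
  have hdG := (contDiffAt_hessGrad hF12 hdet).differentiableAt one_ne_zero
  rw [hN.fderiv_eq, fderiv_fun_smul hdnf.fun_neg hdG, fderiv_fun_neg, fderiv_normalFactor hF hH hU,
    add_apply, smul_apply, fderiv_hessGrad_apply hF hdet, ContinuousLinearMap.smulRight_apply]
  simp only [neg_apply, sub_apply, smul_apply, smul_eq_mul]
  module

lemma shapeTensor_apply (hF : ContDiffAt ℝ 3 F x) (hH : hessDet Ψ F x ≠ 0)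
    (hU : uFun Ψ F x ≠ 0)
    (hN : N =ᶠ[𝓝 x] fun y => (-normalFactor Ψ F y) • hessGrad F y)
    (hμ : muForm Ψ F x =
      ((uFun Ψ F x)⁻¹ * hessDet Ψ F x * (1 - aFun Ψ F x)) • fderiv ℝ F x) (v : Space n) :
    shapeTensor Ψ F N x v = normalFactor Ψ F x •
      (v - sharp F x (thirdForm F x v (hessGrad F x)) +
        ((hessDet Ψ F x)⁻¹ * fderiv ℝ (hessDet Ψ F) x v +
          (uFun Ψ F x)⁻¹ * hessDet Ψ F x * (((n : ℝ) + 2) * aFun Ψ F x - ((n : ℝ) + 1)) *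
            fderiv ℝ F x v) • hessGrad F x) := by
  rw [shapeTensor, add_apply, neg_apply, smul_apply, ContinuousLinearMap.smulRight_apply,
    fderiv_apply_of_eventuallyEq hF hH hU hN, hμ, hN.eq_of_nhds, conormal_eq,
    ← inv_uPow_mul_normalFactor hU]
  simp only [smul_apply, smul_eq_mul]
  module

lemma sharp_thirdForm_apply (hF : ContDiffAt ℝ 3 F x) (i j : Fin (n + 1)) (v : Space n) :
    sharp F x (thirdForm F x (basisVec i) v) j =
      ∑ p, ∑ q, third F x i p q * (hess F x)⁻¹ q j * v p := by
  rw [sharp_apply, Matrix.mulVec, dotProduct, Finset.sum_comm]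
  refine Finset.sum_congr rfl fun q _ => ?_
  rw [apply_eq_sum_basisVec (thirdForm F x (basisVec i)) v, sum_apply, Finset.mul_sum]
  refine Finset.sum_congr rfl fun p _ => ?_
  rw [smul_apply, smul_eq_mul, third_apply hF,
    (inv_hess_isSymm (hF.of_le (by norm_num))).apply q j]
  ring

lemma shapeTensor_basisVec_apply (hF : ContDiffAt ℝ 3 F x) (hH : hessDet Ψ F x ≠ 0)
    (hU : uFun Ψ F x ≠ 0)
    (hN : N =ᶠ[𝓝 x] fun y => (-normalFactor Ψ F y) • hessGrad F y)
    (hμ : muForm Ψ F x =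
      ((uFun Ψ F x)⁻¹ * hessDet Ψ F x * (1 - aFun Ψ F x)) • fderiv ℝ F x) (i j : Fin (n + 1)) :
    shapeTensor Ψ F N x (basisVec i) j = shapeComponents Ψ F x i j := by
  have hδ : basisVec i j = if i = j then (1 : ℝ) else 0 := by
    simp only [basisVec, Pi.single_apply, eq_comm]
  rw [shapeTensor_apply hF hH hU hN hμ, Pi.smul_apply, Pi.add_apply, Pi.sub_apply, Pi.smul_apply,
    sharp_thirdForm_apply hF, hδ]
  rfl

lemma trace_shapeTensor (hF : ContDiffAt ℝ 3 F x) (hH : hessDet Ψ F x ≠ 0)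
    (hU : uFun Ψ F x ≠ 0)
    (hN : N =ᶠ[𝓝 x] fun y => (-normalFactor Ψ F y) • hessGrad F y)
    (hμ : muForm Ψ F x =
      ((uFun Ψ F x)⁻¹ * hessDet Ψ F x * (1 - aFun Ψ F x)) • fderiv ℝ F x) :
    LinearMap.trace ℝ (Space n) (shapeTensor Ψ F N x).toLinearMap =
      ((n : ℝ) + 2) * normalFactor Ψ F x * aFun Ψ F x := by
  set k := (uFun Ψ F x)⁻¹ * hessDet Ψ F x * (((n : ℝ) + 2) * aFun Ψ F x - ((n : ℝ) + 1)) with hk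
  -- Symmetry of the third derivatives puts `F_{ip}^j F^p` in the form of Jacobi's formula, whose
  -- trace `d log H(F^i)` cancels against that of `d log H ⊗ F^i`.
  have hS : (shapeTensor Ψ F N x).toLinearMap = normalFactor Ψ F x •
      (LinearMap.id - sharp F x ∘ₗ (thirdForm F x (hessGrad F x)).toLinearMap +
        ((hessDet Ψ F x)⁻¹ • fderiv ℝ (hessDet Ψ F) x + k • fderiv ℝ F x).toLinearMap.smulRight
          (hessGrad F x)) := by
    refine LinearMap.ext fun v => ?_
    simp [shapeTensor_apply hF hH hU hN hμ, thirdForm_comm hF _ (hessGrad F x), hk]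
  have hjacobi := fderiv_hessDet_apply (Ψ := Ψ) hF (det_hess_ne_zero hH) (hessGrad F x)
  rw [hS, map_smul, map_add, map_sub, LinearMap.trace_id, LinearMap.trace_smulRight]
  simp only [Module.finrank_fintype_fun_eq_card, Fintype.card_fin, Nat.cast_add, Nat.cast_one, hk,
    ContinuousLinearMap.toLinearMap_add, ContinuousLinearMap.toLinearMap_smul, LinearMap.add_apply,
    LinearMap.smul_apply, ContinuousLinearMap.coe_coe, hjacobi, smul_eq_mul,
    fderiv_apply_hessGrad hH]
  field_simp
  ring

lemma meanCurvature_eq_trace {S : tangent F x →ₗ[ℝ] tangent F x} {T : Space n →ₗ[ℝ] Space n}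
    (hT : ∀ v, T v ∈ tangent F x) (hS : ∀ X : tangent F x, (S X : Space n) = T X) :
    meanCurvature S = 1 / (n : ℝ) * LinearMap.trace ℝ (Space n) T := by
  obtain rfl : S = T.restrict fun v _ => hT v := LinearMap.ext fun X => Subtype.ext (hS X)
  rw [meanCurvature, LinearMap.trace_restrict_eq_of_forall_mem _ T hT]

lemma IsShapeOperator.meanCurvature_eq {S : tangent F x →ₗ[ℝ] tangent F x}
    (hS : IsShapeOperator F N x S) (hD : IsNondegenerateOn Ψ F W)
    (hN : IsEquiaffineNormal Ψ F W N) (hx : x ∈ W)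
    (hNG : N =ᶠ[𝓝 x] fun y => (-normalFactor Ψ F y) • hessGrad F y)
    (hμ : muForm Ψ F x =
      ((uFun Ψ F x)⁻¹ * hessDet Ψ F x * (1 - aFun Ψ F x)) • fderiv ℝ F x) :
    meanCurvature S = ((n : ℝ) + 2) / n * normalFactor Ψ F x * aFun Ψ F x := by
  rw [meanCurvature_eq_trace (fderiv_apply_shapeTensor hD hN hx) (hS.apply_eq hN hx),
    trace_shapeTensor (hD.contDiffAt hx 3) (hD.hessDet_ne_zero x hx) (hD.uFun_ne_zero x hx) hNG hμ]
  ring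

end Shape

end LevelSetAffine

open LevelSetAffine in
theorem mainTheorem11_general {n : ℕ} (_hn : 1 ≤ n) {Ψ : VolForm n} {F : Space n → ℝ}
    {W : Set (Space n)} (hD : IsNondegenerateOn Ψ F W) {I : Set ℝ} (hI : MapsTo F W I) :
    (∃ N : Space n → Space n, IsEquiaffineNormal Ψ F W N) ∧
    ∀ N : Space n → Space n, IsEquiaffineNormal Ψ F W N →
      List.TFAE [
        ∀ r ∈ I, IsLocallyConstant (fun x : levelSet F W r => uFun Ψ F x),
        ∀ x ∈ W, ∀ u v, wedge (muForm Ψ F) (conormal Ψ F) x u v = 0,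
        ∀ x ∈ W, muForm Ψ F x =
          ((uFun Ψ F x)⁻¹ * hessDet Ψ F x * (1 - aFun Ψ F x)) • fderiv ℝ F x,
        ∀ x ∈ W, extD (conormal Ψ F) x = 0,
        FlowPreservesLevelSets F W N,
        ∀ x ∈ W, lieD N (conormal Ψ F) x = 0,
        ∀ x ∈ W, ∃ c : ℝ, N x = c • hessGrad F x,
        ∀ x ∈ W, N x = (-normalFactor Ψ F x) • hessGrad F x] ∧
      ((∀ r ∈ I, IsLocallyConstant (fun x : levelSet F W r => uFun Ψ F x)) →
        (∀ x ∈ W, ∃ S, IsShapeOperator F N x S) ∧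
        (∀ x ∈ W, ∀ S, IsShapeOperator F N x S →
          meanCurvature S = ((n : ℝ) + 2) / n * normalFactor Ψ F x * aFun Ψ F x ∧
          ∀ X : tangent F x, (S X : Space n) = shapeTensor Ψ F N x X) ∧
        (∀ x ∈ W, ∀ i j, shapeTensor Ψ F N x (basisVec i) j = shapeComponents Ψ F x i j) ∧
        (∀ x ∈ W, ∀ v, fderiv ℝ F x (shapeTensor Ψ F N x v) = 0)) := by
  have hH := hD.hessDet_ne_zero
  have hU := hD.uFun_ne_zero
  refine ⟨⟨_, isEquiaffineNormal_affineNormal hD⟩, fun N hN => ?_⟩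
  have hloc := forall_isLocallyConstant_uFun_iff hD hI
  have hμ := forall₂_congr fun x hx => muForm_eq_iff (hH x hx) (hU x hx)
  have hcol := forall₂_congr fun x hx => eq_smul_hessGrad_iff hD hN hx
  have hnormal := forall₂_congr fun x hx => eq_neg_normalFactor_smul_iff hD hN hx
  refine ⟨?_, fun h => ?_⟩
  · tfae_have 1 ↔ 7 := hloc.trans hcol.symm
    tfae_have 2 ↔ 7 := (forall₂_congr fun x hx =>
      wedge_conormal_eq_zero_iff (hH x hx) (hU x hx)).trans hcol.symm
    tfae_have 3 ↔ 7 := hμ.trans hcol.symm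
    tfae_have 4 ↔ 2 := forall₂_congr fun x hx =>
      extD_conormal_eq_zero_iff (hD.contDiffAt hx 3) (hU x hx)
    tfae_have 5 ↔ 7 := (hN.flowPreservesLevelSets_iff hD).trans hcol.symm
    tfae_have 6 ↔ 7 :=
      (forall₂_congr fun x hx => lieD_conormal_eq_zero_iff hD hN hx).trans hcol.symm
    tfae_have 8 ↔ 7 := hnormal
    tfae_finish
  · have hμ' := hμ.2 (hloc.1 h)
    have hN' (x) (hx : x ∈ W) := eventually_of_mem (hD.isOpen.mem_nhds hx)
      (hnormal.2 (hcol.2 (hloc.1 h)))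
    exact ⟨fun x hx => hN.exists_isShapeOperator hx, fun x hx S hS =>
      ⟨hS.meanCurvature_eq hD hN hx (hN' x hx) (hμ' x hx), hS.apply_eq hN hx⟩,
      fun x hx => shapeTensor_basisVec_apply (hD.contDiffAt hx 3) (hH x hx) (hU x hx) (hN' x hx)
        (hμ' x hx), fun x hx => fderiv_apply_shapeTensor hD hN hx⟩

open LevelSetAffine in
theorem mainTheorem11 (n : ℕ) (hn : 1 ≤ n) (Ψ : VolForm n) (hΨ : Ψ ≠ 0)
    (Ω : Set (Space n)) (hΩ : IsOpen Ω) (hΩc : IsConnected Ω)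
    (I : Set ℝ) (hI : IsOpen I) (hIc : IsConnected I)
    (F : Space n → ℝ) (hF : ContDiffOn ℝ ∞ F Ω)
    (W : Set (Space n)) (hW : W = Ω ∩ F ⁻¹' I)
    (hH : ∀ x ∈ W, hessDet Ψ F x ≠ 0) (hU : ∀ x ∈ W, uFun Ψ F x ≠ 0) :
    (∃ N : Space n → Space n, IsEquiaffineNormal Ψ F W N) ∧
    ∀ N : Space n → Space n, IsEquiaffineNormal Ψ F W N →
      List.TFAE [
        ∀ r ∈ I, IsLocallyConstant (fun x : levelSet F W r => uFun Ψ F x),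
        ∀ x ∈ W, ∀ u v, wedge (muForm Ψ F) (conormal Ψ F) x u v = 0,
        ∀ x ∈ W, muForm Ψ F x =
          ((uFun Ψ F x)⁻¹ * hessDet Ψ F x * (1 - aFun Ψ F x)) • fderiv ℝ F x,
        ∀ x ∈ W, extD (conormal Ψ F) x = 0,
        FlowPreservesLevelSets F W N,
        ∀ x ∈ W, lieD N (conormal Ψ F) x = 0,
        ∀ x ∈ W, ∃ c : ℝ, N x = c • hessGrad F x,
        ∀ x ∈ W, N x = (-normalFactor Ψ F x) • hessGrad F x] ∧
      ((∀ r ∈ I, IsLocallyConstant (fun x : levelSet F W r => uFun Ψ F x)) →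
        (∀ x ∈ W, ∃ S, IsShapeOperator F N x S) ∧
        (∀ x ∈ W, ∀ S, IsShapeOperator F N x S →
          meanCurvature S = ((n : ℝ) + 2) / n * normalFactor Ψ F x * aFun Ψ F x ∧
          ∀ X : tangent F x, (S X : Space n) = shapeTensor Ψ F N x X) ∧
        (∀ x ∈ W, ∀ i j, shapeTensor Ψ F N x (basisVec i) j = shapeComponents Ψ F x i j) ∧
        (∀ x ∈ W, ∀ v, fderiv ℝ F x (shapeTensor Ψ F N x v) = 0)) := by
  subst hW
  exact mainTheorem11_general hn ⟨hF.continuousOn.isOpen_inter_preimage hΩ hI,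
    hF.mono inter_subset_left, hH, hU⟩ fun _ hx => hx.2
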